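/- Let $d\ge 2$ and let $f=(p,q)\colon\mathbb C^2\to\mathbb C^2$ be a regular polynomial endomorphism of degree $d$: $p,q\in\mathbb C[x,y]$ have degree at most $d$, and their homogeneous parts $p_d,q_d$ of degree $d$ have no common zero other than $(0,0)$. Then $f$ extends to the holomorphic map $F\colon\mathbb P^2\to\mathbb P^2$, $$F[x:y:z]=[z^dp(x/z,y/z):z^dq(x/z,y/z):z^d],$$ which maps the line at infinity $L_\infty=\{z=0\}\cong\mathbb P^1$ to itself by the rational map $f_\infty[x:y]=[p_d(x,y):q_d(x,y)]$ of degree $d$. Let $J_\infty\subset L_\infty$ be the Julia set of $f_\infty$. For an open set $\Omega\supseteq J_\infty$ of $\mathbb P^2$, let $$\mathcal W^s_\Omega(J_\infty)=\{x\in\mathbb P^2 : F^n(x)\in\Omega\text{ for all }n\ge 0\text{ and }F^n(x)\to J_\infty\text{ as }n\to\infty\}$$ be the local stable manifold of $J_\infty$ relative to $\Omega$. Suppose that $f_\infty$ is conjugate, by a Möbius transformation, to $z\mapsto z^d$. Then the local stable manifold of $J_\infty$ is real analytic: there is an open neighborhood $\Omega_0$ of $J_\infty$ such that, for every open set $\Omega$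 with $J_\infty\subseteq\Omega\subseteq\Omega_0$, the set $\mathcal W^s_\Omega(J_\infty)$ is a real analytic submanifold of $\mathbb P^2$ of real dimension $3$ (near each of its points it is the zero set of a real analytic function with non-vanishing differential). -/

import Mathlib

open scoped LinearAlgebra.Projectivization Topology
open Filter MvPolynomial

namespace RegEndo

noncomputable section

/-! ### Complex projective space and the maps induced by homogeneous polynomials -/

/-- Complex projective space of dimension `n`. -/
abbrev CP (n : ℕ) : Type := ℙ ℂ (Fin (n + 1) → ℂ)

/-- The usual topology of projective space: the quotient topology from nonzero vectors. -/
instance instTopologicalSpaceCP (n : ℕ) : TopologicalSpace (CP n) :=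
  inferInstanceAs
    (TopologicalSpace (Quotient (projectivizationSetoid ℂ (Fin (n + 1) → ℂ))))

/-- A tuple of homogeneous polynomials of degree `d` with no common zero except the origin. -/
def IsNondegenerate {n m : ℕ} (d : ℕ) (Φ : Fin (m + 1) → MvPolynomial (Fin (n + 1)) ℂ) : Prop :=
  (∀ i, (Φ i).IsHomogeneous d) ∧ ∀ v : Fin (n + 1) → ℂ, (∀ i, eval v (Φ i) = 0) → v = 0

theorem eval_smul_of_isHomogeneous {n d : ℕ} {P : MvPolynomial (Fin n) ℂ}
    (hP : P.IsHomogeneous d) (t : ℂ) (v : Fin n → ℂ) :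
    eval (t • v) P = t ^ d * eval v P := by
  rw [eval_eq, eval_eq, Finset.mul_sum]
  refine Finset.sum_congr rfl fun e he => ?_
  have h : ∑ i, e i = d := by
    have := hP (mem_support_iff.mp he)
    simpa [Finsupp.weight_apply, Finsupp.sum_fintype] using this
  have h2 : ∏ i ∈ e.support, t ^ e i = t ^ d := by
    rw [Finset.prod_pow_eq_pow_sum, ← h]
    congr 1
    exact Finset.sum_subset (Finset.subset_univ _) (by simp)
  simp only [Pi.smul_apply, smul_eq_mul, mul_pow, Finset.prod_mul_distrib]
  rw [h2]; ring

/-- The holomorphic map `[v] ↦ [Φ 0 (v) : ⋯ : Φ m (v)]` of projective spaces. -/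
def projMap {n m d : ℕ} {Φ : Fin (m + 1) → MvPolynomial (Fin (n + 1)) ℂ}
    (hΦ : IsNondegenerate d Φ) : CP n → CP m :=
  Projectivization.lift
    (fun v => Projectivization.mk ℂ (fun i => eval v.1 (Φ i))
      (fun h => v.2 (hΦ.2 v.1 (fun i => congrFun h i))))
    (fun a b t hab => by
      rw [Projectivization.mk_eq_mk_iff']
      refine ⟨t ^ d, ?_⟩
      funext i
      simp only [Pi.smul_apply, smul_eq_mul]
      rw [hab, eval_smul_of_isHomogeneous (hΦ.1 i)])

/-! ### Regular polynomial endomorphisms of the plane -/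

/-- `f = (f 0, f 1)` is a regular polynomial endomorphism of `ℂ²` of degree `d`: the components
have degree at most `d`, and their homogeneous parts of degree `d` have no common zero except the
origin (for `d ≥ 1` both parts are then nonzero, so both components have degree exactly `d`). -/
def IsRegular (d : ℕ) (f : Fin 2 → MvPolynomial (Fin 2) ℂ) : Prop :=
  (∀ i, (f i).totalDegree ≤ d) ∧
    ∀ v : Fin 2 → ℂ, (∀ i, eval v (homogeneousComponent d (f i)) = 0) → v = 0

/-- The homogenization `z ^ d * P (x / z, y / z)` of a polynomial `P (x, y)` of degree `≤ d`. -/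
def homog (d : ℕ) (P : MvPolynomial (Fin 2) ℂ) : MvPolynomial (Fin 3) ℂ :=
  ∑ k ∈ Finset.range (d + 1),
    X 2 ^ (d - k) * rename Fin.castSucc (homogeneousComponent k P)

theorem homog_isHomogeneous (d : ℕ) (P : MvPolynomial (Fin 2) ℂ) :
    (homog d P).IsHomogeneous d := by
  refine IsHomogeneous.sum _ _ _ fun k hk => ?_
  have h := (isHomogeneous_X_pow (R := ℂ) (2 : Fin 3) (d - k)).mul
    ((homogeneousComponent_isHomogeneous k P).rename_isHomogeneous (f := Fin.castSucc))
  rwa [Nat.sub_add_cancel (by simpa [Nat.lt_succ_iff] using hk)] at h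

theorem eval_homog_of_eq_zero (d : ℕ) (P : MvPolynomial (Fin 2) ℂ) (v : Fin 3 → ℂ)
    (hv : v 2 = 0) :
    eval v (homog d P) = eval (fun i : Fin 2 => v i.castSucc) (homogeneousComponent d P) := by
  rw [homog, map_sum, Finset.sum_range_succ, Finset.sum_eq_zero]
  · simp [eval_rename, Function.comp_def]
  · intro k hk
    have : d - k ≠ 0 := by have := Finset.mem_range.mp hk; omega
    simp [hv, this]

theorem eval_homog_of_eq_one {d : ℕ} {P : MvPolynomial (Fin 2) ℂ} (hP : P.totalDegree ≤ d)
    (v : Fin 3 → ℂ) (hv : v 2 = 1) :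
    eval v (homog d P) = eval (fun i : Fin 2 => v i.castSucc) P := by
  have h : ∑ k ∈ Finset.range (d + 1), homogeneousComponent k P = P := by
    conv_rhs => rw [← sum_homogeneousComponent P]
    symm
    refine Finset.sum_subset (Finset.range_mono (by omega)) fun k _ hk => ?_
    exact homogeneousComponent_eq_zero _ _ (by simpa [Nat.lt_succ_iff] using hk)
  conv_rhs => rw [← h]
  simp [homog, hv, eval_rename, Function.comp_def, map_sum]

/-- The homogeneous polynomials `(x, y, z) ↦ (z ^ d f (x / z, y / z), z ^ d)`. -/
def extensionPolys (d : ℕ) (f : Fin 2 → MvPolynomial (Fin 2) ℂ) :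
    Fin 3 → MvPolynomial (Fin 3) ℂ :=
  ![homog d (f 0), homog d (f 1), X 2 ^ d]

theorem IsRegular.nondegenerate_extension {d : ℕ} {f : Fin 2 → MvPolynomial (Fin 2) ℂ}
    (hf : IsRegular d f) : IsNondegenerate (n := 2) (m := 2) d (extensionPolys d f) := by
  constructor
  · intro i
    fin_cases i
    · exact homog_isHomogeneous d (f 0)
    · exact homog_isHomogeneous d (f 1)
    · exact isHomogeneous_X_pow _ _
  · intro v hv
    have h2 : v 2 = 0 := by
      have : v 2 ^ d = 0 := by simpa [extensionPolys] using hv 2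
      exact eq_zero_of_pow_eq_zero this
    have h0 := hv 0
    have h1 := hv 1
    simp only [extensionPolys, Matrix.cons_val_zero, Matrix.cons_val_one] at h0 h1
    rw [eval_homog_of_eq_zero d _ v h2] at h0 h1
    have h := hf.2 (fun i : Fin 2 => v i.castSucc) (by intro i; fin_cases i <;> assumption)
    funext i
    fin_cases i
    · exact congrFun h 0
    · exact congrFun h 1
    · exact h2

/-- The holomorphic extension of `f` to the projective plane. -/
def IsRegular.extension {d : ℕ} {f : Fin 2 → MvPolynomial (Fin 2) ℂ} (hf : IsRegular d f) :
    CP 2 → CP 2 :=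
  projMap hf.nondegenerate_extension

theorem IsRegular.nondegenerate_atInfinity {d : ℕ} {f : Fin 2 → MvPolynomial (Fin 2) ℂ}
    (hf : IsRegular d f) :
    IsNondegenerate (n := 1) (m := 1) d (fun i => homogeneousComponent d (f i)) :=
  ⟨fun i => homogeneousComponent_isHomogeneous d (f i), hf.2⟩

/-- The restriction of the extension of `f` to the line at infinity, the latter being identified
with the projective line through `[x : y] ↦ [x : y : 0]` (see `extension_lineAtInfinity`). -/
def IsRegular.atInfinity {d : ℕ} {f : Fin 2 → MvPolynomial (Fin 2) ℂ} (hf : IsRegular d f) :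
    CP 1 → CP 1 :=
  projMap hf.nondegenerate_atInfinity

/-- The parametrization `[x : y] ↦ [x : y : 0]` of the line at infinity. -/
def lineAtInfinity : CP 1 → CP 2 :=
  Projectivization.lift
    (fun v => Projectivization.mk ℂ (![v.1 0, v.1 1, 0] : Fin 3 → ℂ) (fun h => v.2 (by
      funext i
      fin_cases i
      · exact congrFun h 0
      · exact congrFun h 1)))
    (fun a b t hab => by
      rw [Projectivization.mk_eq_mk_iff']
      refine ⟨t, ?_⟩
      funext i
      fin_cases i <;> simp [hab])

/-- The `i`-th standard affine chart of the projective plane, `a ↦ [⋯ : 1 : ⋯]` with the entry `1`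
in position `i` and the two coordinates of `a` in the remaining positions. -/
def affineChart (i : Fin 3) (a : Fin 2 → ℂ) : CP 2 :=
  Projectivization.mk ℂ (Fin.insertNth i (1 : ℂ) a : Fin 3 → ℂ) (fun h => by
    have := congrFun h i
    simp at this)

theorem IsRegular.extension_lineAtInfinity {d : ℕ} (hd : d ≠ 0)
    {f : Fin 2 → MvPolynomial (Fin 2) ℂ} (hf : IsRegular d f) (x : CP 1) :
    hf.extension (lineAtInfinity x) = lineAtInfinity (hf.atInfinity x) := by
  induction x using Projectivization.ind with
  | h v hv =>
    simp only [extension, atInfinity, lineAtInfinity, projMap, Projectivization.lift_mk]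
    congr 1
    funext i
    have e : (fun i : Fin 2 => (![v 0, v 1, 0] : Fin 3 → ℂ) i.castSucc) = v := by
      funext i; fin_cases i <;> rfl
    fin_cases i
    · have := eval_homog_of_eq_zero d (f 0) ![v 0, v 1, 0] rfl
      rw [e] at this
      exact this
    · have := eval_homog_of_eq_zero d (f 1) ![v 0, v 1, 0] rfl
      rw [e] at this
      exact this
    · simp [extensionPolys, hd]

theorem IsRegular.extension_affine {d : ℕ} {f : Fin 2 → MvPolynomial (Fin 2) ℂ}
    (hf : IsRegular d f) (a : Fin 2 → ℂ) :
    hf.extension (affineChart 2 a) = affineChart 2 (fun i => eval a (f i)) := by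
  simp only [extension, affineChart, projMap, Projectivization.lift_mk]
  congr 1
  funext i
  have e : (fun i : Fin 2 => (Fin.insertNth (2 : Fin 3) (1 : ℂ) a : Fin 3 → ℂ) i.castSucc) = a := by
    funext i; fin_cases i <;> rfl
  fin_cases i
  · have := eval_homog_of_eq_one (hf.1 0) (Fin.insertNth (2 : Fin 3) (1 : ℂ) a) rfl
    rw [e] at this
    exact this
  · have := eval_homog_of_eq_one (hf.1 1) (Fin.insertNth (2 : Fin 3) (1 : ℂ) a) rfl
    rw [e] at this
    exact this
  · simp [extensionPolys]

/-! ### Dynamics on the projective line -/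

theorem nondegenerate_pow (d : ℕ) :
    IsNondegenerate (n := 1) (m := 1) d (fun i => (X i : MvPolynomial (Fin 2) ℂ) ^ d) :=
  ⟨fun i => isHomogeneous_X_pow i d, fun v hv => funext fun i =>
    eq_zero_of_pow_eq_zero (by simpa using hv i)⟩

/-- The map `z ↦ z ^ d` of the Riemann sphere, in homogeneous coordinates
`[x : y] ↦ [x ^ d : y ^ d]`. -/
def powMap (d : ℕ) : CP 1 → CP 1 :=
  projMap (nondegenerate_pow d)

/-- Two self-maps of the projective line are conjugate if some projective linear (Möbius)
transformation carries one to the other. -/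
def MobiusConjugate (g h : CP 1 → CP 1) : Prop :=
  ∃ A : (Fin 2 → ℂ) ≃ₗ[ℂ] (Fin 2 → ℂ),
    g ∘ Projectivization.map A.toLinearMap A.injective =
      Projectivization.map A.toLinearMap A.injective ∘ h

/-- The chordal distance on the projective line. -/
def chordalDist (x y : CP 1) : ℝ :=
  ‖x.rep 0 * y.rep 1 - x.rep 1 * y.rep 0‖ /
    (√(‖x.rep 0‖ ^ 2 + ‖x.rep 1‖ ^ 2) * √(‖y.rep 0‖ ^ 2 + ‖y.rep 1‖ ^ 2))

theorem chordalDist_mk (v w : Fin 2 → ℂ) (hv : v ≠ 0) (hw : w ≠ 0) :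
    chordalDist (Projectivization.mk ℂ v hv) (Projectivization.mk ℂ w hw) =
      ‖v 0 * w 1 - v 1 * w 0‖ /
        (√(‖v 0‖ ^ 2 + ‖v 1‖ ^ 2) * √(‖w 0‖ ^ 2 + ‖w 1‖ ^ 2)) := by
  obtain ⟨a, ha⟩ := Projectivization.exists_smul_eq_mk_rep ℂ v hv
  obtain ⟨b, hb⟩ := Projectivization.exists_smul_eq_mk_rep ℂ w hw
  have key : ∀ (c : ℂˣ) (u : Fin 2 → ℂ),
      √(‖(c • u) 0‖ ^ 2 + ‖(c • u) 1‖ ^ 2) = ‖(c : ℂ)‖ * √(‖u 0‖ ^ 2 + ‖u 1‖ ^ 2) := by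
    intro c u
    have : ‖(c • u) 0‖ ^ 2 + ‖(c • u) 1‖ ^ 2 = ‖(c : ℂ)‖ ^ 2 * (‖u 0‖ ^ 2 + ‖u 1‖ ^ 2) := by
      simp only [Units.smul_def, Pi.smul_apply, smul_eq_mul, norm_mul]; ring
    rw [this, Real.sqrt_mul (by positivity), Real.sqrt_sq (norm_nonneg _)]
  have num : (a • v) 0 * (b • w) 1 - (a • v) 1 * (b • w) 0 =
      ((a : ℂ) * b) * (v 0 * w 1 - v 1 * w 0) := by
    simp only [Units.smul_def, Pi.smul_apply, smul_eq_mul]; ring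
  have hab : ‖(a : ℂ)‖ * ‖(b : ℂ)‖ ≠ 0 :=
    mul_ne_zero (norm_ne_zero_iff.mpr a.ne_zero) (norm_ne_zero_iff.mpr b.ne_zero)
  rw [chordalDist, ← ha, ← hb, key, key, num, norm_mul, norm_mul, mul_mul_mul_comm,
    mul_div_mul_left _ _ hab]

/-- The Fatou set of a self-map `g` of the Riemann sphere: the largest open set on which the
iterates of `g` are equicontinuous for the chordal distance. -/
def fatouSet (g : CP 1 → CP 1) : Set (CP 1) :=
  {x | ∃ U : Set (CP 1), IsOpen U ∧ x ∈ U ∧ ∀ y ∈ U, ∀ ε > 0, ∀ᶠ y' in 𝓝 y,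
    ∀ n : ℕ, chordalDist (g^[n] y) (g^[n] y') < ε}

/-- The Julia set: the complement of the Fatou set. -/
def juliaSet (g : CP 1 → CP 1) : Set (CP 1) := (fatouSet g)ᶜ

/-- The Julia set of the restriction of `f` to the line at infinity, as a subset of the
projective plane. -/
def IsRegular.juliaAtInfinity {d : ℕ} {f : Fin 2 → MvPolynomial (Fin 2) ℂ} (hf : IsRegular d f) :
    Set (CP 2) :=
  lineAtInfinity '' juliaSet hf.atInfinity

/-! ### Local stable sets and real analyticity -/

/-- The local stable set of `S` relative to `Ω`: the points whose forward orbit stays in `Ω` and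
converges to `S` (eventually enters every neighbourhood of `S`). -/
def localStableSet {Y : Type*} [TopologicalSpace Y] (F : Y → Y) (S Ω : Set Y) : Set Y :=
  {x | (∀ n : ℕ, F^[n] x ∈ Ω) ∧ Tendsto (fun n : ℕ => F^[n] x) atTop (𝓝ˢ S)}

/-- `M` is an (embedded) real analytic submanifold of real codimension one of the real normed
space `E`: near each of its points it is the zero set of a real analytic function with nowhere
vanishing differential. -/
def IsRealAnalyticHypersurface {E : Type*} [NormedAddCommGroup E] [NormedSpace ℝ E]
    (M : Set E) : Prop :=
  ∀ x ∈ M, ∃ (U : Set E) (ψ : E → ℝ), IsOpen U ∧ x ∈ U ∧ AnalyticOnNhd ℝ ψ U ∧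
    (∀ y ∈ U, fderiv ℝ ψ y ≠ 0) ∧ M ∩ U = {y | ψ y = 0} ∩ U

/-- `M` is an (embedded) real analytic submanifold of real codimension one, that is, of real
dimension three, of the projective plane: it is one in each of the three standard affine charts
(which are open, cover the plane, and have biholomorphic transition maps). -/
def IsRealAnalyticHypersurfaceCP2 (M : Set (CP 2)) : Prop :=
  ∀ i : Fin 3, IsRealAnalyticHypersurface (affineChart i ⁻¹' M)

end

end RegEndo

namespace RegEndo

/-! ### Uniformly convergent series of analytic functions of several complex variables -/

section Weierstrass

variable {E F : Type*} [NormedAddCommGroup E] [NormedSpace ℂ E] [NormedAddCommGroup F]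
  [NormedSpace ℂ F] [CompleteSpace F]

/-! The stable set is a level set of the modulus of a holomorphic function. The conjugacy of the map
at infinity to the power map gives a linear change of coordinates of `ℂ³`, fixing `z`, in which the
homogeneous lift of `F` is `(c x^d + z r₀, c y^d + z r₁, z^d)`. The factor `c` is constant by
Liouville (`exists_const_of_proportional_pow`, `exists_normalForm`). In these coordinates `J_∞` is
the circle `|x| = |y|` in the line `z = 0`.

With `p_j = z r_j / (c u_j^d)`, the first two coordinates are multiplied by `1 + p_j` relative to
the pure power map. The quotient of the two Böttcher coordinates is `φ(u) = (y/x) ∏ ((1 + p₁(F^k u))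
/ (1 + p₀(F^k u)))^(1/d^(k+1))`. It converges on an invariant cone around the lifted `J_∞`, is
homogeneous of degree `0`, and satisfies `φ ∘ F = φ^d` (`slope_map_le`, `bottcher_map`). Its
holomorphy is the several-variable Weierstrass theorem `analyticAt_tsum_of_norm_le`, applied to the
logarithm of the product.

If an orbit tends to `J_∞`, then `|φ|^(d^n)` stays away from `0` and `∞`, so `|φ| = 1`
(`norm_bottcher_eq_one`). Conversely, points of the cone with `|φ| = 1` converge to `J_∞` uniformly
(`exists_forall_iterate_mem_tube`). By uniformity, remaining in `Ω` is automatic after a fixed time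
`n₀`, and before `n₀` it is an open condition. Hence near each of its points the stable set is
exactly `{|φ| = 1}`, for every admissible `Ω`.

On `z = 0` one has `φ = y/x`, so `dφ ≠ 0` near `J_∞`. The set `Ω₀` is the part of the cone where `dφ
≠ 0`; there `|φ|² - 1` is real analytic with nonzero differential because `φ` does not vanish. -/

theorem norm_iteratedFDeriv_le_of_norm_le {f : E → F} {x : E} {R M h : ℝ}
    (hh : 0 < h) (hf : AnalyticOnNhd ℂ f (Metric.ball x R))
    (hb : ∀ y ∈ Metric.ball x R, ‖f y‖ ≤ M) (n : ℕ) :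
    ∀ y ∈ Metric.ball x (R - n * h), ‖iteratedFDeriv ℂ n f y‖ ≤ M * (2 / h) ^ n := by
  induction n with
  | zero => simpa using hb
  | succ n ih =>
    intro y hy
    have hsub : Metric.ball y h ⊆ Metric.ball x (R - n * h) := by
      apply Metric.ball_subset_ball'
      have := Metric.mem_ball.mp hy
      push_cast at this
      linarith
    have hsub' : Metric.ball x (R - n * h) ⊆ Metric.ball x R :=
      Metric.ball_subset_ball (by have : 0 ≤ (n : ℝ) * h := by positivity
                                  linarith)
    have hd : DifferentiableOn ℂ (iteratedFDeriv ℂ n f) (Metric.ball y h) :=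
      ((hf.iteratedFDeriv n).mono (hsub.trans hsub')).differentiableOn
    -- Schwarz-type bound on a ball of radius `h`: two values of the `n`-th derivative differ by at
    -- most twice its bound, whence the factor `2`. Each differentiation costs `h` of the radius.
    have key := Complex.norm_fderiv_le_div_of_mapsTo_ball (R₂ := 2 * (M * (2 / h) ^ n)) hd
      (fun w hw => by
        rw [Metric.mem_closedBall, dist_eq_norm]
        have h1 := ih w (hsub hw)
        have h2 := ih y (hsub (Metric.mem_ball_self hh))
        exact (norm_sub_le _ _).trans (by linarith)) hh
    rw [iteratedFDeriv_succ_eq_comp_left, Function.comp_apply, LinearIsometryEquiv.norm_map]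
    refine key.trans_eq ?_
    rw [pow_succ]
    field_simp

/-- The normalized Taylor series of a function at a point. -/
noncomputable def taylorFPS (f : E → F) (x : E) : FormalMultilinearSeries ℂ E F :=
  fun n => ((n.factorial : ℂ))⁻¹ • iteratedFDeriv ℂ n f x

theorem norm_taylorFPS_le {f : E → F} {x : E} {R M : ℝ} (hR : 0 < R) (hM : 0 ≤ M)
    (hf : AnalyticOnNhd ℂ f (Metric.ball x R))
    (hb : ∀ y ∈ Metric.ball x R, ‖f y‖ ≤ M) (n : ℕ) :
    ‖taylorFPS f x n‖ ≤ M * Real.exp 1 * (2 * Real.exp 1 / R) ^ n := by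
  have hn : (0 : ℝ) < n + 1 := by positivity
  -- With `h = R / (n + 1)` a ball of radius `R / (n + 1)` is left after `n` differentiations. The
  -- resulting factor `(n + 1)^n` is absorbed by `n!` at the cost of `e^(n + 1)`.
  have h1 := norm_iteratedFDeriv_le_of_norm_le (h := R / (n + 1)) (by positivity) hf hb n x
    (Metric.mem_ball_self (by
      have : (n : ℝ) * (R / (n + 1)) = R - R / (n + 1) := by field_simp; ring
      rw [this]
      have : 0 < R / (n + 1) := by positivity
      linarith))
  have h2 : ((n : ℝ) + 1) ^ n / n.factorial ≤ Real.exp 1 ^ (n + 1) := by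
    have := Real.pow_div_factorial_le_exp (x := (n : ℝ) + 1) hn.le n
    rwa [← Real.exp_nat_mul, Nat.cast_succ, mul_one]
  have hfac : (0 : ℝ) < n.factorial := by exact_mod_cast n.factorial_pos
  rw [taylorFPS, norm_smul, norm_inv, Complex.norm_natCast]
  calc (n.factorial : ℝ)⁻¹ * ‖iteratedFDeriv ℂ n f x‖
      ≤ (n.factorial : ℝ)⁻¹ * (M * (2 / (R / (n + 1))) ^ n) := by gcongr
    _ = M * (2 / R) ^ n * (((n : ℝ) + 1) ^ n / n.factorial) := by
        rw [show (2 : ℝ) / (R / (n + 1)) = 2 / R * (n + 1) by field_simp, mul_pow]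
        field_simp
    _ ≤ M * (2 / R) ^ n * Real.exp 1 ^ (n + 1) := by gcongr
    _ = _ := by rw [mul_comm 2 (Real.exp 1), mul_div_assoc, mul_pow, pow_succ]; ring

/-- The coefficient bounds make the Taylor series converge on a ball depending only on `R`, and the
identity theorem propagates its local agreement with `f` to that ball. A radius independent of `f`
is what permits summing a family of such series. -/
theorem hasFPowerSeriesOnBall_taylorFPS {f : E → F} {x : E} {R M : ℝ} (hR : 0 < R) (hM : 0 ≤ M)
    (hf : AnalyticOnNhd ℂ f (Metric.ball x R))
    (hb : ∀ y ∈ Metric.ball x R, ‖f y‖ ≤ M) {ρ : NNReal} (hρ0 : 0 < ρ)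
    (hρ : (ρ : ℝ) * (2 * Real.exp 1) ≤ R) :
    HasFPowerSeriesOnBall f (taylorFPS f x) x ρ := by
  have hρR : (ρ : ℝ) ≤ R := by
    have : (1 : ℝ) ≤ 2 * Real.exp 1 := by
      have := Real.add_one_le_exp (1 : ℝ); linarith
    nlinarith [ρ.2]
  have hrad : (ρ : ENNReal) ≤ (taylorFPS f x).radius := by
    refine FormalMultilinearSeries.le_radius_of_bound _ (M * Real.exp 1) fun n => ?_
    calc ‖taylorFPS f x n‖ * (ρ : ℝ) ^ n
        ≤ M * Real.exp 1 * (2 * Real.exp 1 / R) ^ n * (ρ : ℝ) ^ n := by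
          gcongr; exact norm_taylorFPS_le hR hM hf hb n
      _ = M * Real.exp 1 * (ρ * (2 * Real.exp 1) / R) ^ n := by
          rw [mul_assoc, ← mul_pow]; congr 2; ring
      _ ≤ M * Real.exp 1 * 1 := by
          gcongr
          exact pow_le_one₀ (by positivity) ((div_le_one hR).mpr hρ)
      _ = _ := mul_one _
  have hρE : (0 : ENNReal) < ρ := by exact_mod_cast hρ0
  have hrpos := hρE.trans_le hrad
  have hsum := (FormalMultilinearSeries.hasFPowerSeriesOnBall _ hrpos).mono hρE hrad
  obtain ⟨p, r, hp⟩ := hf x (Metric.mem_ball_self hR)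
  have hev : ∀ᶠ y in 𝓝 x, f y = (taylorFPS f x).sum (y - x) := by
    filter_upwards [Metric.eball_mem_nhds x hp.r_pos] with y hy
    have := hp.hasSum_iteratedFDeriv (y := y - x) (by
      rw [Metric.mem_eball] at hy ⊢
      simpa [edist_eq_enorm_sub] using hy)
    rw [add_sub_cancel] at this
    exact this.tsum_eq.symm
  have hball : Metric.eball x (ρ : ENNReal) = Metric.ball x ρ := Metric.eball_coe
  have hEq : Set.EqOn f (fun y => (taylorFPS f x).sum (y - x)) (Metric.ball x ρ) := by
    refine AnalyticOnNhd.eqOn_of_preconnected_of_eventuallyEq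
      (hf.mono (Metric.ball_subset_ball hρR)) ?_ (convex_ball x (ρ : ℝ)).isPreconnected
      (Metric.mem_ball_self (by exact_mod_cast hρ0)) hev
    intro y hy
    have h0 := hsum.analyticOnNhd (y - x) (by
      rw [← hball, Metric.mem_eball] at hy
      rw [Metric.mem_eball]
      simpa [edist_eq_enorm_sub] using hy)
    exact h0.comp_of_eq (analyticAt_id.sub analyticAt_const) rfl
  refine ⟨hrad, hρE, fun {y} hy => ?_⟩
  have hy' : x + y ∈ Metric.ball x ρ := by
    rw [Metric.eball_coe] at hy
    simpa using hy
  rw [hEq hy']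
  simpa using hsum.hasSum hy

/-- The Taylor series are added coefficientwise. The bounds are geometric in the degree and summable
in the index, so the double family is absolutely summable and the two summations can be exchanged.
-/
theorem analyticAt_tsum_of_norm_le {ι : Type*} {f : ι → E → F} {u : ι → ℝ} {x : E} {R : ℝ}
    (hR : 0 < R) (hu : Summable u) (hu0 : ∀ k, 0 ≤ u k)
    (hf : ∀ k, AnalyticOnNhd ℂ (f k) (Metric.ball x R))
    (hb : ∀ k, ∀ y ∈ Metric.ball x R, ‖f k y‖ ≤ u k) :
    AnalyticAt ℂ (fun y => ∑' k, f k y) x := by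
  have he : 0 < Real.exp 1 := Real.exp_pos 1
  -- This radius makes the ratio `2e/R` of the coefficient bounds, times `ρ`, equal to `1/2`.
  set ρ : NNReal := (R / (4 * Real.exp 1)).toNNReal
  have hρ : (ρ : ℝ) = R / (4 * Real.exp 1) := Real.coe_toNNReal _ (by positivity)
  have hρ0 : 0 < ρ := by rw [← NNReal.coe_pos, hρ]; positivity
  have hK : 2 * Real.exp 1 / R * ρ = 1 / 2 := by rw [hρ]; field_simp; norm_num
  have hps : ∀ k, HasFPowerSeriesOnBall (f k) (taylorFPS (f k) x) x ρ := fun k =>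
    hasFPowerSeriesOnBall_taylorFPS hR (hu0 k) (hf k) (hb k) hρ0 (by rw [hρ]; field_simp; norm_num)
  have hnorm : ∀ k n, ‖taylorFPS (f k) x n‖ ≤ u k * Real.exp 1 * (2 * Real.exp 1 / R) ^ n :=
    fun k n => norm_taylorFPS_le hR (hu0 k) (hf k) (hb k) n
  have hsumP : ∀ n, Summable fun k => taylorFPS (f k) x n := fun n =>
    Summable.of_norm_bounded ((hu.mul_right _).mul_right _) fun k => hnorm k n
  let P : FormalMultilinearSeries ℂ E F := fun n => ∑' k, taylorFPS (f k) x n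
  have hPnorm : ∀ n, ‖P n‖ ≤ (∑' k, u k) * Real.exp 1 * (2 * Real.exp 1 / R) ^ n := fun n =>
    tsum_of_norm_bounded ((hu.hasSum.mul_right _).mul_right _) fun k => hnorm k n
  have htot : 0 ≤ ∑' k, u k := tsum_nonneg hu0
  refine ⟨P, ρ, ⟨?_, by exact_mod_cast hρ0, fun {y} hy => ?_⟩⟩
  · refine FormalMultilinearSeries.le_radius_of_bound _ ((∑' k, u k) * Real.exp 1) fun n => ?_
    calc ‖P n‖ * (ρ : ℝ) ^ n
        ≤ (∑' k, u k) * Real.exp 1 * (2 * Real.exp 1 / R) ^ n * (ρ : ℝ) ^ n := by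
          gcongr; exact hPnorm n
      _ = (∑' k, u k) * Real.exp 1 * (1 / 2) ^ n := by rw [mul_assoc, ← mul_pow, hK]
      _ ≤ (∑' k, u k) * Real.exp 1 * 1 := by
          gcongr; exact pow_le_one₀ (by norm_num) (by norm_num)
      _ = _ := mul_one _
  · have hyρ : ‖y‖ ≤ ρ := by
      have : y ∈ Metric.ball (0 : E) ρ := by rwa [← Metric.eball_coe]
      exact (mem_ball_zero_iff.mp this).le
    let a : ι → ℕ → F := fun k n => taylorFPS (f k) x n fun _ => y
    have hdbl : Summable fun q : ι × ℕ => a q.1 q.2 := by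
      refine Summable.of_norm_bounded (g := fun q : ι × ℕ => (u q.1 * Real.exp 1) * (1 / 2) ^ q.2)
        ((hu.mul_right _).mul_of_nonneg summable_geometric_two
          (fun k => mul_nonneg (hu0 k) he.le) (fun n => by positivity)) ?_
      rintro ⟨k, n⟩
      calc ‖taylorFPS (f k) x n fun _ => y‖ ≤ ‖taylorFPS (f k) x n‖ * ‖y‖ ^ n := by
            simpa using (taylorFPS (f k) x n).le_opNorm fun _ => y
        _ ≤ u k * Real.exp 1 * (2 * Real.exp 1 / R) ^ n * (ρ : ℝ) ^ n := by
            gcongr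
            · exact mul_nonneg (mul_nonneg (hu0 k) he.le) (by positivity)
            · exact hnorm k n
        _ = _ := by rw [mul_assoc, ← mul_pow, hK]
    have h1 : HasSum (fun q : ι × ℕ => a q.1 q.2) (∑' k, f k (x + y)) := by
      have := hdbl.hasSum.prod_fiberwise fun k => (hps k).hasSum hy
      rw [this.tsum_eq]
      exact hdbl.hasSum
    have h2 : HasSum (fun q : ℕ × ι => a q.2 q.1) (∑' k, f k (x + y)) :=
      (Equiv.prodComm ι ℕ).symm.hasSum_iff (f := fun q : ι × ℕ => a q.1 q.2) |>.mpr h1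
    exact h2.prod_fiberwise fun n => ContinuousMultilinearMap.hasSum_eval (hsumP n).hasSum _

end Weierstrass

/-! ### Maps of `ℂ³` that are a power map on the plane at infinity -/

/-- The larger modulus of the first two coordinates. -/
noncomputable def bigMod (u : Fin 3 → ℂ) : ℝ := max ‖u 0‖ ‖u 1‖

/-- The smaller modulus of the first two coordinates. -/
noncomputable def smallMod (u : Fin 3 → ℂ) : ℝ := min ‖u 0‖ ‖u 1‖

theorem norm_castSucc_le_bigMod (u : Fin 3 → ℂ) (j : Fin 2) : ‖u j.castSucc‖ ≤ bigMod u := by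
  fin_cases j
  · exact le_max_left _ _
  · exact le_max_right _ _

theorem smallMod_le_norm_castSucc (u : Fin 3 → ℂ) (j : Fin 2) :
    smallMod u ≤ ‖u j.castSucc‖ := by
  fin_cases j
  · exact min_le_left _ _
  · exact min_le_right _ _

theorem smallMod_nonneg (u : Fin 3 → ℂ) : 0 ≤ smallMod u :=
  le_min (norm_nonneg _) (norm_nonneg _)

theorem smallMod_le_bigMod (u : Fin 3 → ℂ) : smallMod u ≤ bigMod u := min_le_max

theorem bigMod_nonneg (u : Fin 3 → ℂ) : 0 ≤ bigMod u :=
  (smallMod_nonneg u).trans (smallMod_le_bigMod u)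

theorem bigMod_smul (t : ℂ) (u : Fin 3 → ℂ) : bigMod (t • u) = ‖t‖ * bigMod u := by
  simp [bigMod, mul_max_of_nonneg]

theorem smallMod_smul (t : ℂ) (u : Fin 3 → ℂ) : smallMod (t • u) = ‖t‖ * smallMod u := by
  simp [smallMod, mul_min_of_nonneg]

theorem continuous_bigMod : Continuous bigMod := by unfold bigMod; fun_prop

theorem continuous_smallMod : Continuous smallMod := by unfold smallMod; fun_prop

/-- Data defining a homogeneous map of `ℂ³` of degree `d` which is of the form
`(c x ^ d + z r₀, c y ^ d + z r₁, z ^ d)`. -/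
structure NormalForm (d : ℕ) where
  two_le : 2 ≤ d
  c : ℂ
  c_ne : c ≠ 0
  r : Fin 2 → (Fin 3 → ℂ) → ℂ
  C : ℝ
  C_nonneg : 0 ≤ C
  analytic : ∀ j, AnalyticOnNhd ℂ (r j) Set.univ
  bound : ∀ j u, ‖r j u‖ ≤ C * ‖u‖ ^ (d - 1)
  homogeneous : ∀ j (t : ℂ) u, r j (t • u) = t ^ (d - 1) * r j u

namespace NormalForm

noncomputable section

variable {d : ℕ} (N : NormalForm d)

/-- The map defined by a normal form. -/
def map (u : Fin 3 → ℂ) : Fin 3 → ℂ :=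
  Fin.snoc (α := fun _ => ℂ) (fun j : Fin 2 => N.c * u j.castSucc ^ d + u 2 * N.r j u) (u 2 ^ d)

theorem map_castSucc (u : Fin 3 → ℂ) (j : Fin 2) :
    N.map u j.castSucc = N.c * u j.castSucc ^ d + u 2 * N.r j u := Fin.snoc_castSucc ..

theorem map_two (u : Fin 3 → ℂ) : N.map u 2 = u 2 ^ d := Fin.snoc_last (n := 2) ..

theorem d_pos {d : ℕ} (N : NormalForm d) : 0 < d := by have := N.two_le; omega

theorem pow_pred_mul {d : ℕ} (N : NormalForm d) (a : ℂ) : a * a ^ (d - 1) = a ^ d :=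
  mul_pow_sub_one N.d_pos.ne' a

theorem map_smul (t : ℂ) (u : Fin 3 → ℂ) : N.map (t • u) = t ^ d • N.map u := by
  funext i
  refine Fin.lastCases ?_ (fun j => ?_) i
  · change N.map (t • u) 2 = t ^ d * N.map u 2
    simp [map_two, mul_pow]
  · change _ = t ^ d * N.map u j.castSucc
    rw [map_castSucc, map_castSucc, N.homogeneous]
    simp only [Pi.smul_apply, smul_eq_mul, mul_pow]
    rw [← N.pow_pred_mul t]
    ring

theorem iterate_map_smul (n : ℕ) (t : ℂ) (u : Fin 3 → ℂ) :
    N.map^[n] (t • u) = t ^ d ^ n • N.map^[n] u := by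
  induction n with
  | zero => simp
  | succ n ih =>
    rw [Function.iterate_succ_apply', Function.iterate_succ_apply', ih, map_smul, ← pow_mul,
      pow_succ]

theorem analyticAt_coord (i : Fin 3) (u : Fin 3 → ℂ) :
    AnalyticAt ℂ (fun u : Fin 3 → ℂ => u i) u :=
  (ContinuousLinearMap.proj (R := ℂ) (φ := fun _ : Fin 3 => ℂ) i).analyticAt u

theorem analyticAt_map (u : Fin 3 → ℂ) : AnalyticAt ℂ N.map u := by
  rw [analyticAt_pi_iff]
  intro i
  refine Fin.lastCases ?_ (fun j => ?_) i
  · change AnalyticAt ℂ (fun u => N.map u 2) u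
    simp only [map_two]
    exact (analyticAt_coord 2 u).pow d
  · simp only [map_castSucc]
    exact (analyticAt_const.mul ((analyticAt_coord _ u).pow d)).add
      ((analyticAt_coord 2 u).mul (N.analytic j u trivial))

theorem analyticAt_iterate_map (n : ℕ) (u : Fin 3 → ℂ) : AnalyticAt ℂ N.map^[n] u := by
  induction n with
  | zero => exact analyticAt_id
  | succ n ih =>
    rw [Function.iterate_succ']
    exact (N.analyticAt_map _).comp ih

theorem continuous_iterate_map (n : ℕ) : Continuous N.map^[n] :=
  continuous_iff_continuousAt.mpr fun u => (N.analyticAt_iterate_map n u).continuousAt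

/-! ### The invariant cone and the contraction of the slope. -/

/-- The width of the invariant neighbourhood. -/
def width : ℝ := min 1 (min (‖N.c‖ / (2 * 4 ^ d)) (‖N.c‖ / (2 * (N.C + 1))))

theorem norm_c_pos : 0 < ‖N.c‖ := norm_pos_iff.mpr N.c_ne

theorem width_pos : 0 < N.width := by
  have := N.norm_c_pos
  have := N.C_nonneg
  unfold width
  positivity

/-- An invariant open cone around the lifted Julia set of the power map. -/
def cone : Set (Fin 3 → ℂ) :=
  {u | ‖u 2‖ * bigMod u ^ (d - 1) < N.width * smallMod u ^ d}

/-- The relative distance to the plane at infinity. -/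
def slope (_ : NormalForm d) (u : Fin 3 → ℂ) : ℝ := ‖u 2‖ * bigMod u ^ (d - 1) / smallMod u ^ d

theorem isOpen_cone : IsOpen N.cone :=
  isOpen_lt (by have := continuous_bigMod; fun_prop) (by have := continuous_smallMod; fun_prop)

theorem slope_nonneg (u : Fin 3 → ℂ) : 0 ≤ N.slope u :=
  div_nonneg (mul_nonneg (norm_nonneg _) (pow_nonneg (bigMod_nonneg u) _))
    (pow_nonneg (smallMod_nonneg u) _)

theorem smallMod_pos {u : Fin 3 → ℂ} (hu : u ∈ N.cone) : 0 < smallMod u := by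
  refine (smallMod_nonneg u).lt_of_ne' fun h => ?_
  have h1 : ‖u 2‖ * bigMod u ^ (d - 1) < N.width * smallMod u ^ d := hu
  rw [h, zero_pow N.d_pos.ne', mul_zero] at h1
  exact h1.not_ge (mul_nonneg (norm_nonneg _) (pow_nonneg (bigMod_nonneg u) _))

theorem slope_lt {u : Fin 3 → ℂ} (hu : u ∈ N.cone) : N.slope u < N.width :=
  (div_lt_iff₀ (pow_pos (N.smallMod_pos hu) d)).mpr hu

theorem mem_cone_iff {u : Fin 3 → ℂ} (h : 0 < smallMod u) : u ∈ N.cone ↔ N.slope u < N.width :=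
  (div_lt_iff₀ (pow_pos h d)).symm

theorem castSucc_ne_zero {u : Fin 3 → ℂ} (hu : u ∈ N.cone) (j : Fin 2) : u j.castSucc ≠ 0 :=
  norm_pos_iff.mp ((N.smallMod_pos hu).trans_le (smallMod_le_norm_castSucc u j))

theorem norm_two_le_slope_mul {u : Fin 3 → ℂ} (hu : u ∈ N.cone) :
    ‖u 2‖ ≤ N.slope u * smallMod u := by
  have hm := N.smallMod_pos hu
  have hM : smallMod u ^ (d - 1) ≤ bigMod u ^ (d - 1) :=
    pow_le_pow_left₀ hm.le (smallMod_le_bigMod u) _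
  rw [slope, ← mul_pow_sub_one N.d_pos.ne' (smallMod u), div_mul_eq_mul_div,
    le_div_iff₀ (by positivity)]
  calc ‖u 2‖ * (smallMod u * smallMod u ^ (d - 1))
      ≤ ‖u 2‖ * (smallMod u * bigMod u ^ (d - 1)) := by gcongr
    _ = _ := by ring

theorem norm_le_bigMod {u : Fin 3 → ℂ} (hu : u ∈ N.cone) : ‖u‖ ≤ bigMod u := by
  refine (pi_norm_le_iff_of_nonneg (bigMod_nonneg u)).mpr fun i => ?_
  refine Fin.lastCases ?_ (fun j => norm_castSucc_le_bigMod u j) i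
  change ‖u 2‖ ≤ _
  have h1 : N.slope u ≤ 1 := (N.slope_lt hu).le.trans (min_le_left _ _)
  calc ‖u 2‖ ≤ N.slope u * smallMod u := N.norm_two_le_slope_mul hu
    _ ≤ 1 * bigMod u := mul_le_mul h1 (smallMod_le_bigMod u) (smallMod_nonneg u) zero_le_one
    _ = _ := one_mul _

/-- The relative perturbation of the power map. -/
def pert (j : Fin 2) (u : Fin 3 → ℂ) : ℂ := u 2 * N.r j u / (N.c * u j.castSucc ^ d)

theorem map_castSucc_eq {u : Fin 3 → ℂ} {j : Fin 2} (hu : u j.castSucc ≠ 0) :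
    N.map u j.castSucc = N.c * u j.castSucc ^ d * (1 + N.pert j u) := by
  have := N.c_ne
  rw [map_castSucc, pert]
  field_simp

/-- The slope is designed for this estimate: the numerator is at most `C |z| M^(d-1)` and the
denominator at least `|c| m^d`, where `M` and `m` are the larger and smaller modulus. -/
theorem norm_pert_le {u : Fin 3 → ℂ} (hu : u ∈ N.cone) (j : Fin 2) :
    ‖N.pert j u‖ ≤ N.C / ‖N.c‖ * N.slope u := by
  have hm := N.smallMod_pos hu
  have hc := N.norm_c_pos
  have hC := N.C_nonneg
  have hM := bigMod_nonneg u
  rw [pert, norm_div, norm_mul, norm_mul, norm_pow]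
  calc ‖u 2‖ * ‖N.r j u‖ / (‖N.c‖ * ‖u j.castSucc‖ ^ d)
      ≤ ‖u 2‖ * (N.C * bigMod u ^ (d - 1)) / (‖N.c‖ * smallMod u ^ d) := by
        gcongr
        · exact (N.bound j u).trans (by gcongr; exact N.norm_le_bigMod hu)
        · exact smallMod_le_norm_castSucc u j
    _ = _ := by rw [slope]; field_simp

theorem norm_pert_le_half {u : Fin 3 → ℂ} (hu : u ∈ N.cone) (j : Fin 2) :
    ‖N.pert j u‖ ≤ 1 / 2 := by
  have hc := N.norm_c_pos
  have hC := N.C_nonneg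
  refine (N.norm_pert_le hu j).trans ?_
  have h1 : N.slope u ≤ ‖N.c‖ / (2 * (N.C + 1)) :=
    (N.slope_lt hu).le.trans ((min_le_right _ _).trans (min_le_right _ _))
  calc N.C / ‖N.c‖ * N.slope u ≤ (N.C + 1) / ‖N.c‖ * (‖N.c‖ / (2 * (N.C + 1))) := by
        gcongr
        · exact N.slope_nonneg u
        · linarith
    _ = 1 / 2 := by field_simp

theorem norm_map_castSucc_bounds {u : Fin 3 → ℂ} (hu : u ∈ N.cone) (j : Fin 2) :
    ‖N.c‖ / 2 * smallMod u ^ d ≤ ‖N.map u j.castSucc‖ ∧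
      ‖N.map u j.castSucc‖ ≤ 2 * ‖N.c‖ * bigMod u ^ d := by
  have hm := N.smallMod_pos hu
  have hc := N.norm_c_pos
  have hp := N.norm_pert_le_half hu j
  have hlow : 1 / 2 ≤ ‖1 + N.pert j u‖ := by
    have := norm_sub_norm_le (1 : ℂ) (-N.pert j u)
    rw [norm_one, norm_neg, sub_neg_eq_add] at this
    linarith
  have hup : ‖1 + N.pert j u‖ ≤ 2 := by
    have := norm_add_le (1 : ℂ) (N.pert j u)
    rw [norm_one] at this
    linarith
  have h1 : smallMod u ^ d ≤ ‖u j.castSucc‖ ^ d :=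
    pow_le_pow_left₀ hm.le (smallMod_le_norm_castSucc u j) _
  have h2 : ‖u j.castSucc‖ ^ d ≤ bigMod u ^ d :=
    pow_le_pow_left₀ (norm_nonneg _) (norm_castSucc_le_bigMod u j) _
  rw [N.map_castSucc_eq (N.castSucc_ne_zero hu j), norm_mul, norm_mul, norm_pow]
  have hM := bigMod_nonneg u
  constructor
  · calc ‖N.c‖ / 2 * smallMod u ^ d = ‖N.c‖ * smallMod u ^ d * (1 / 2) := by ring
      _ ≤ _ := by gcongr
  · calc ‖N.c‖ * ‖u j.castSucc‖ ^ d * ‖1 + N.pert j u‖ ≤ ‖N.c‖ * bigMod u ^ d * 2 := by gcongr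
      _ = _ := by ring

/-- Since `z` becomes `z^d` and the other moduli are distorted by a factor at most `2` relative to
`|c|` times a `d`-th power, the new slope is at most `2^(2d-1)/|c|` times the `d`-th power of the
old one: the line at infinity is superattracting. -/
theorem slope_map_le {u : Fin 3 → ℂ} (hu : u ∈ N.cone) :
    0 < smallMod (N.map u) ∧ N.slope (N.map u) ≤ N.slope u / 2 := by
  have hm := N.smallMod_pos hu
  have hc := N.norm_c_pos
  have hM := bigMod_nonneg u
  have hb := N.norm_map_castSucc_bounds hu
  have h1 : ‖N.c‖ / 2 * smallMod u ^ d ≤ smallMod (N.map u) := le_min (hb 0).1 (hb 1).1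
  have h2 : bigMod (N.map u) ≤ 2 * ‖N.c‖ * bigMod u ^ d := max_le (hb 0).2 (hb 1).2
  have hs := N.slope_nonneg u
  refine ⟨lt_of_lt_of_le (by positivity) h1, ?_⟩
  obtain ⟨e, rfl⟩ : ∃ e, d = e + 2 := ⟨d - 2, by have := N.two_le; omega⟩
  -- Here `d ≥ 2` is used: one power of the slope remains among the `d - 1` spare ones, and the
  -- bound `|c| / (2 * 4^d)` in `width` turns the constant above into `1/4`.
  have h3 : N.slope u ^ (e + 1) ≤ ‖N.c‖ / (2 * 4 ^ (e + 2)) := by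
    have hw : N.slope u ≤ 1 := (N.slope_lt hu).le.trans (min_le_left _ _)
    calc N.slope u ^ (e + 1) ≤ N.slope u ^ 1 := pow_le_pow_of_le_one hs hw (by omega)
      _ = N.slope u := pow_one _
      _ ≤ _ := (N.slope_lt hu).le.trans ((min_le_right _ _).trans (min_le_left _ _))
  have h4 : N.slope (N.map u) ≤ 2 ^ (2 * e + 3) / ‖N.c‖ * N.slope u ^ (e + 2) := by
    have hbm := bigMod_nonneg (N.map u)
    calc N.slope (N.map u)
        = ‖u 2‖ ^ (e + 2) * bigMod (N.map u) ^ (e + 1) / smallMod (N.map u) ^ (e + 2) := by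
          rw [slope, map_two, norm_pow]; rfl
      _ ≤ ‖u 2‖ ^ (e + 2) * (2 * ‖N.c‖ * bigMod u ^ (e + 2)) ^ (e + 1) /
          (‖N.c‖ / 2 * smallMod u ^ (e + 2)) ^ (e + 2) := by gcongr
      _ = _ := by
          rw [slope, show e + 2 - 1 = e + 1 from rfl]
          simp only [mul_pow, div_pow, ← pow_mul]
          rw [mul_comm (e + 2) (e + 1), show 2 * e + 3 = (e + 1) + (e + 2) by ring, pow_add 2]
          rw [pow_succ (‖N.c‖) (e + 1)]
          field_simp
          ring
  calc N.slope (N.map u) ≤ 2 ^ (2 * e + 3) / ‖N.c‖ * N.slope u ^ (e + 2) := h4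
    _ = 2 ^ (2 * e + 3) / ‖N.c‖ * N.slope u * N.slope u ^ (e + 1) := by ring
    _ ≤ 2 ^ (2 * e + 3) / ‖N.c‖ * N.slope u * (‖N.c‖ / (2 * 4 ^ (e + 2))) := by gcongr
    _ = N.slope u / 4 := by
        rw [show (4 : ℝ) = 2 ^ 2 by norm_num, ← pow_mul]
        field_simp
        ring
    _ ≤ N.slope u / 2 := by linarith

theorem map_mem_cone {u : Fin 3 → ℂ} (hu : u ∈ N.cone) : N.map u ∈ N.cone := by
  obtain ⟨h1, h2⟩ := N.slope_map_le hu
  rw [N.mem_cone_iff h1]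
  have := N.slope_lt hu
  have := N.slope_nonneg u
  linarith

theorem iterate_map_mem_cone {u : Fin 3 → ℂ} (hu : u ∈ N.cone) (n : ℕ) :
    N.map^[n] u ∈ N.cone := by
  induction n with
  | zero => exact hu
  | succ n ih => rw [Function.iterate_succ_apply']; exact N.map_mem_cone ih

theorem slope_iterate_map_le {u : Fin 3 → ℂ} (hu : u ∈ N.cone) (n : ℕ) :
    N.slope (N.map^[n] u) ≤ N.slope u * (1 / 2) ^ n := by
  induction n with
  | zero => simp
  | succ n ih =>
    rw [Function.iterate_succ_apply']
    have := (N.slope_map_le (N.iterate_map_mem_cone hu n)).2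
    rw [pow_succ]
    linarith

/-! #### The Böttcher quotient -/

/-- The terms of the series for the logarithm of the correction factor. -/
def logTerm (k : ℕ) (u : Fin 3 → ℂ) : ℂ :=
  (Complex.log (1 + N.pert 1 (N.map^[k] u)) - Complex.log (1 + N.pert 0 (N.map^[k] u))) /
    (d : ℂ) ^ (k + 1)

/-- The logarithm of the correction factor. -/
def logCorr (u : Fin 3 → ℂ) : ℂ := ∑' k, N.logTerm k u

/-- The quotient of the two Böttcher coordinates. -/
def bottcher (u : Fin 3 → ℂ) : ℂ := u 1 / u 0 * Complex.exp (N.logCorr u)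

/-- The geometric factor comes from `d^(k+1) ≥ 2^(k+1)`; of the slope along the orbit only the bound
by its initial value is used. Keeping that value in the estimate makes the correction small near
infinity. -/
theorem norm_logTerm_le {u : Fin 3 → ℂ} (hu : u ∈ N.cone) (k : ℕ) :
    ‖N.logTerm k u‖ ≤ 3 * N.C / ‖N.c‖ * N.slope u * ((1 / 2) ^ (k + 1)) := by
  have hC := N.C_nonneg
  have hc := N.norm_c_pos
  have hv := N.iterate_map_mem_cone hu k
  set v := N.map^[k] u
  have hl : ∀ j, ‖Complex.log (1 + N.pert j v)‖ ≤ 3 / 2 * (N.C / ‖N.c‖ * N.slope u) := fun j => by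
    refine (Complex.norm_log_one_add_half_le_self (N.norm_pert_le_half hv j)).trans ?_
    gcongr
    refine (N.norm_pert_le hv j).trans ?_
    gcongr
    refine (N.slope_iterate_map_le hu k).trans ?_
    exact mul_le_of_le_one_right (N.slope_nonneg u) (pow_le_one₀ (by norm_num) (by norm_num))
  have hs := N.slope_nonneg u
  have hd : (2 : ℝ) ≤ d := by exact_mod_cast N.two_le
  rw [logTerm, norm_div, norm_pow, Complex.norm_natCast]
  calc _ ≤ (3 / 2 * (N.C / ‖N.c‖ * N.slope u) + 3 / 2 * (N.C / ‖N.c‖ * N.slope u)) /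
        (2 : ℝ) ^ (k + 1) := by
        gcongr
        exact (norm_sub_le _ _).trans (add_le_add (hl 1) (hl 0))
    _ = _ := by rw [one_div, inv_pow]; field_simp; ring

theorem hasSum_half_pow_succ : HasSum (fun k : ℕ => ((1 : ℝ) / 2) ^ (k + 1)) 1 := by
  have := (hasSum_geometric_two).mul_right (1 / 2 : ℝ)
  simpa [pow_succ] using this

theorem summable_logTerm {u : Fin 3 → ℂ} (hu : u ∈ N.cone) : Summable fun k => N.logTerm k u :=
  Summable.of_norm_bounded (hasSum_half_pow_succ.summable.mul_left _) (N.norm_logTerm_le hu)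

theorem norm_logCorr_le {u : Fin 3 → ℂ} (hu : u ∈ N.cone) :
    ‖N.logCorr u‖ ≤ 3 * N.C / ‖N.c‖ * N.slope u := by
  have := tsum_of_norm_bounded
    (hasSum_half_pow_succ.mul_left (3 * N.C / ‖N.c‖ * N.slope u)) (N.norm_logTerm_le hu)
  rwa [mul_one] at this

theorem one_add_pert_mem_slitPlane {u : Fin 3 → ℂ} (hu : u ∈ N.cone) (j : Fin 2) :
    1 + N.pert j u ∈ Complex.slitPlane := by
  left
  have h1 := (abs_le.mp ((Complex.abs_re_le_norm _).trans (N.norm_pert_le_half hu j))).1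
  rw [Complex.add_re, Complex.one_re]
  linarith

theorem analyticAt_logTerm {u : Fin 3 → ℂ} (hu : u ∈ N.cone) (k : ℕ) :
    AnalyticAt ℂ (N.logTerm k) u := by
  have hv := N.iterate_map_mem_cone hu k
  have hp : ∀ j, AnalyticAt ℂ (fun w => Complex.log (1 + N.pert j (N.map^[k] w))) u := fun j => by
    refine AnalyticAt.clog (analyticAt_const.add ?_) (N.one_add_pert_mem_slitPlane hv j)
    refine AnalyticAt.fun_comp (g := N.pert j) ?_ (N.analyticAt_iterate_map k u)
    refine ((analyticAt_coord 2 _).mul (N.analytic j _ trivial)).div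
      (analyticAt_const.mul ((analyticAt_coord _ _).pow d)) ?_
    exact mul_ne_zero N.c_ne (pow_ne_zero _ (N.castSucc_ne_zero hv j))
  exact ((hp 1).sub (hp 0)).div analyticAt_const
    (pow_ne_zero _ (by exact_mod_cast N.d_pos.ne'))

theorem analyticAt_logCorr {u : Fin 3 → ℂ} (hu : u ∈ N.cone) : AnalyticAt ℂ N.logCorr u := by
  obtain ⟨R, hR, hball⟩ := Metric.isOpen_iff.mp N.isOpen_cone u hu
  have hC := N.C_nonneg
  have hc := N.norm_c_pos
  have hw := N.width_pos
  refine analyticAt_tsum_of_norm_le (u := fun k => 3 * N.C / ‖N.c‖ * N.width * (1 / 2) ^ (k + 1))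
    hR (hasSum_half_pow_succ.summable.mul_left _) (fun k => by positivity)
    (fun k y hy => N.analyticAt_logTerm (hball hy) k) fun k y hy => ?_
  refine (N.norm_logTerm_le (hball hy) k).trans ?_
  gcongr
  exact (N.slope_lt (hball hy)).le

theorem analyticAt_bottcher {u : Fin 3 → ℂ} (hu : u ∈ N.cone) : AnalyticAt ℂ N.bottcher u :=
  ((analyticAt_coord 1 u).div (analyticAt_coord 0 u) (N.castSucc_ne_zero hu 0)).mul
    (N.analyticAt_logCorr hu).cexp

theorem bottcher_ne_zero {u : Fin 3 → ℂ} (hu : u ∈ N.cone) : N.bottcher u ≠ 0 :=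
  mul_ne_zero (div_ne_zero (N.castSucc_ne_zero hu 1) (N.castSucc_ne_zero hu 0))
    (Complex.exp_ne_zero _)

/-- Passing from `u` to its image shifts the series: the `k`-th term at the image is `d` times the
term of index `k + 1` at `u`, so only the initial term is lost. -/
theorem logCorr_map {u : Fin 3 → ℂ} (hu : u ∈ N.cone) :
    N.logCorr (N.map u) = d * N.logCorr u -
      (Complex.log (1 + N.pert 1 u) - Complex.log (1 + N.pert 0 u)) := by
  have hd : (d : ℂ) ≠ 0 := by exact_mod_cast N.d_pos.ne'
  have h1 : ∀ k, N.logTerm k (N.map u) = d * N.logTerm (k + 1) u := fun k => by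
    rw [logTerm, logTerm, ← Function.iterate_succ_apply, pow_succ _ (k + 1)]
    field_simp
  rw [logCorr, logCorr, (N.summable_logTerm hu).tsum_eq_zero_add, tsum_congr h1, tsum_mul_left,
    mul_add]
  have : (d : ℂ) * N.logTerm 0 u =
      Complex.log (1 + N.pert 1 u) - Complex.log (1 + N.pert 0 u) := by
    rw [logTerm]; simp; field_simp
  rw [this]; ring

/-- The map sends `y/x` to `(y/x)^d (1 + p₁)/(1 + p₀)`, the constant `c` cancelling in the quotient.
The term lost by the shift of `logCorr` compensates the remaining factor exactly. -/
theorem bottcher_map {u : Fin 3 → ℂ} (hu : u ∈ N.cone) :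
    N.bottcher (N.map u) = N.bottcher u ^ d := by
  have h0 := N.castSucc_ne_zero hu 0
  have h1 := N.castSucc_ne_zero hu 1
  have p0 := Complex.slitPlane_ne_zero (N.one_add_pert_mem_slitPlane hu 0)
  have p1 := Complex.slitPlane_ne_zero (N.one_add_pert_mem_slitPlane hu 1)
  have e0 := N.map_castSucc_eq h0
  have e1 := N.map_castSucc_eq h1
  simp only [Fin.castSucc_zero, Fin.castSucc_one] at h0 h1 e0 e1
  have hc := N.c_ne
  rw [bottcher, bottcher, N.logCorr_map hu, Complex.exp_sub, Complex.exp_sub, Complex.exp_log p1,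
    Complex.exp_log p0, Complex.exp_nat_mul, mul_pow, div_pow, e0, e1]
  field_simp

theorem bottcher_iterate_map {u : Fin 3 → ℂ} (hu : u ∈ N.cone) (n : ℕ) :
    N.bottcher (N.map^[n] u) = N.bottcher u ^ d ^ n := by
  induction n with
  | zero => simp
  | succ n ih =>
    rw [Function.iterate_succ_apply', N.bottcher_map (N.iterate_map_mem_cone hu n), ih,
      ← pow_mul, pow_succ]

/-! ### Homogeneity and the derivative of the quotient. -/

theorem smul_mem_cone {t : ℂ} (ht : t ≠ 0) {u : Fin 3 → ℂ} (hu : u ∈ N.cone) :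
    t • u ∈ N.cone := by
  have ht' := norm_pos_iff.mpr ht
  have h : ‖u 2‖ * bigMod u ^ (d - 1) < N.width * smallMod u ^ d := hu
  change ‖(t • u) 2‖ * bigMod (t • u) ^ (d - 1) < N.width * smallMod (t • u) ^ d
  rw [bigMod_smul, smallMod_smul, Pi.smul_apply, smul_eq_mul, norm_mul, mul_pow, mul_pow]
  calc ‖t‖ * ‖u 2‖ * (‖t‖ ^ (d - 1) * bigMod u ^ (d - 1))
      = ‖t‖ ^ d * (‖u 2‖ * bigMod u ^ (d - 1)) := by
        rw [← mul_pow_sub_one N.d_pos.ne' ‖t‖]; ring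
    _ < ‖t‖ ^ d * (N.width * smallMod u ^ d) := by gcongr
    _ = _ := by ring

theorem pert_smul {t : ℂ} (ht : t ≠ 0) (j : Fin 2) (u : Fin 3 → ℂ) :
    N.pert j (t • u) = N.pert j u := by
  rw [pert, pert, N.homogeneous]
  simp only [Pi.smul_apply, smul_eq_mul, mul_pow]
  rw [← mul_div_mul_left (u 2 * N.r j u) _ (pow_ne_zero d ht), ← N.pow_pred_mul t]
  congr 1 <;> ring

theorem logCorr_smul {t : ℂ} (ht : t ≠ 0) (u : Fin 3 → ℂ) : N.logCorr (t • u) = N.logCorr u := by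
  refine tsum_congr fun k => ?_
  rw [logTerm, logTerm, iterate_map_smul, N.pert_smul (pow_ne_zero _ ht),
    N.pert_smul (pow_ne_zero _ ht)]

theorem bottcher_smul {t : ℂ} (ht : t ≠ 0) (u : Fin 3 → ℂ) :
    N.bottcher (t • u) = N.bottcher u := by
  rw [bottcher, bottcher, N.logCorr_smul ht, Pi.smul_apply, Pi.smul_apply, smul_eq_mul,
    smul_eq_mul, mul_div_mul_left _ _ ht]

theorem logCorr_eq_zero {u : Fin 3 → ℂ} (hu : u 2 = 0) : N.logCorr u = 0 := by
  have h : ∀ k, (N.map^[k] u) 2 = 0 := fun k => by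
    induction k with
    | zero => exact hu
    | succ k ih => rw [Function.iterate_succ_apply', map_two, ih, zero_pow N.d_pos.ne']
  have : ∀ k, N.logTerm k u = 0 := fun k => by simp [logTerm, pert, h k]
  simp [logCorr, this]

/-- The correction vanishes on the plane `z = 0`, where the quotient is `y/x`. Moving in the
`y`-direction stays in that plane and gives the derivative `1/x`. -/
theorem fderiv_bottcher_ne_zero {u : Fin 3 → ℂ} (hu : u ∈ N.cone) (h2 : u 2 = 0) :
    fderiv ℂ N.bottcher u ≠ 0 := by
  intro h
  have h0 : u 0 ≠ 0 := N.castSucc_ne_zero hu 0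
  have hline : HasDerivAt (fun s : ℂ => u + s • (Pi.single 1 1 : Fin 3 → ℂ)) (Pi.single 1 1) 0 := by
    simpa using ((hasDerivAt_id (0 : ℂ)).smul_const (Pi.single 1 1 : Fin 3 → ℂ)).const_add u
  have h1 := (N.analyticAt_bottcher hu).differentiableAt.hasFDerivAt
  rw [h] at h1
  have h3 : HasDerivAt (fun s : ℂ => N.bottcher (u + s • (Pi.single 1 1 : Fin 3 → ℂ))) 0 0 := by
    exact HasFDerivAt.comp_hasDerivAt_of_eq (0 : ℂ) h1 hline (by simp)
  have h4 : (fun s : ℂ => N.bottcher (u + s • (Pi.single 1 1 : Fin 3 → ℂ))) =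
      fun s => (u 1 + s) / u 0 := by
    funext s
    rw [bottcher, N.logCorr_eq_zero (by simp [h2])]
    simp
  rw [h4] at h3
  have h5 : HasDerivAt (fun s : ℂ => (u 1 + s) / u 0) (1 / u 0) 0 :=
    ((hasDerivAt_id (0 : ℂ)).const_add (u 1)).div_const (u 0)
  exact one_div_ne_zero h0 (h5.unique h3)

theorem fderiv_bottcher_smul {t : ℂ} (ht : t ≠ 0) (u : Fin 3 → ℂ) :
    fderiv ℂ N.bottcher u = t • fderiv ℂ N.bottcher (t • u) := by
  have h : (fun v => N.bottcher (t • v)) = N.bottcher := funext fun v => N.bottcher_smul ht v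
  conv_lhs => rw [← h]
  exact fderiv_comp_smul t

/-- Euler's identity in degree `0`: the quotient is constant along the punctured complex line
through `u`. -/
theorem fderiv_bottcher_self {u : Fin 3 → ℂ} (hu : u ∈ N.cone) :
    fderiv ℂ N.bottcher u u = 0 := by
  have hline : HasDerivAt (fun s : ℂ => s • u) u 1 := by
    simpa using (hasDerivAt_id (1 : ℂ)).smul_const u
  have h1 := (N.analyticAt_bottcher hu).differentiableAt.hasFDerivAt
  have h3 := HasFDerivAt.comp_hasDerivAt_of_eq (1 : ℂ) h1 hline (by simp)
  refine h3.unique ((hasDerivAt_const (1 : ℂ) (N.bottcher u)).congr_of_eventuallyEq ?_)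
  filter_upwards [isOpen_ne.mem_nhds (one_ne_zero (α := ℂ))] with s hs
  exact N.bottcher_smul hs u

/-- The cone of points of the invariant cone at which the Böttcher quotient is a submersion. -/
def regularCone : Set (Fin 3 → ℂ) := {u ∈ N.cone | fderiv ℂ N.bottcher u ≠ 0}

theorem isOpen_regularCone : IsOpen N.regularCone := by
  have h : ContinuousOn (fderiv ℂ N.bottcher) N.cone := fun u hu =>
    (N.analyticAt_bottcher hu).fderiv.continuousAt.continuousWithinAt
  exact h.isOpen_inter_preimage N.isOpen_cone isOpen_ne

theorem smul_mem_regularCone {t : ℂ} (ht : t ≠ 0) {u : Fin 3 → ℂ} (hu : u ∈ N.regularCone) :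
    t • u ∈ N.regularCone := by
  refine ⟨N.smul_mem_cone ht hu.1, fun h => hu.2 ?_⟩
  rw [N.fderiv_bottcher_smul ht, h]
  exact smul_zero (A := (Fin 3 → ℂ) →L[ℂ] ℂ) t

/-! #### Orbits on the unit level set -/

/-- Homogeneous neighbourhoods of the lifted Julia set of the power map. -/
def tube (δ : ℝ) : Set (Fin 3 → ℂ) := {u | |‖u 1‖ - ‖u 0‖| < δ * ‖u 0‖ ∧ ‖u 2‖ < δ * ‖u 0‖}

theorem norm_bottcher {u : Fin 3 → ℂ} :
    ‖N.bottcher u‖ = ‖u 1‖ / ‖u 0‖ * Real.exp (N.logCorr u).re := by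
  rw [bottcher, norm_mul, norm_div, Complex.norm_exp]

/-- The level `|φ| = 1` is invariant, and on it `|y|/|x| = exp(-Re logCorr)`. Since `logCorr` is
bounded by a multiple of the slope, which at time `n` is at most `width * 2^(-n)` throughout the
cone, the time `n₀` does not depend on the point. -/
theorem exists_forall_iterate_mem_tube {δ : ℝ} (hδ : 0 < δ) :
    ∃ n₀, ∀ n ≥ n₀, ∀ u ∈ N.cone, ‖N.bottcher u‖ = 1 → N.map^[n] u ∈ tube δ := by
  have hC := N.C_nonneg
  have hc := N.norm_c_pos
  have hw := N.width_pos
  set K := 3 * N.C / ‖N.c‖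
  have hK : 0 ≤ K := by positivity
  have hexp : ∀ᶠ x : ℝ in 𝓝 0, |Real.exp x - 1| < δ := by
    have : ContinuousAt (fun x : ℝ => |Real.exp x - 1|) 0 := by fun_prop
    exact this.eventually_lt_const (by simpa using hδ)
  obtain ⟨η, hη, hexp⟩ := Metric.eventually_nhds_iff.mp hexp
  have hlim : Tendsto (fun n : ℕ => N.width * (1 / 2 : ℝ) ^ n) atTop (𝓝 0) := by
    simpa using (tendsto_pow_atTop_nhds_zero_of_lt_one (r := (1 / 2 : ℝ)) (by norm_num)
      (by norm_num)).const_mul N.width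
  have hlim2 : Tendsto (fun n : ℕ => K * (N.width * (1 / 2 : ℝ) ^ n)) atTop (𝓝 0) := by
    simpa using hlim.const_mul K
  obtain ⟨n₀, hn₀⟩ := eventually_atTop.mp
    ((hlim.eventually_lt_const hδ).and (hlim2.eventually_lt_const hη))
  refine ⟨n₀, fun n hn u hu hφ => ?_⟩
  obtain ⟨ha, hb⟩ := hn₀ n hn
  have hv := N.iterate_map_mem_cone hu n
  have hφv : ‖N.bottcher (N.map^[n] u)‖ = 1 := by
    rw [N.bottcher_iterate_map hu, norm_pow, hφ, one_pow]
  have hs : N.slope (N.map^[n] u) ≤ N.width * (1 / 2) ^ n :=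
    (N.slope_iterate_map_le hu n).trans (by gcongr; exact (N.slope_lt hu).le)
  set v := N.map^[n] u
  have h0 : 0 < ‖v 0‖ := norm_pos_iff.mpr (N.castSucc_ne_zero hv 0)
  have hl : |(N.logCorr v).re| ≤ K * (N.width * (1 / 2) ^ n) :=
    (Complex.abs_re_le_norm _).trans ((N.norm_logCorr_le hv).trans (by gcongr))
  constructor
  · have h1 : ‖v 1‖ = ‖v 0‖ * Real.exp (-(N.logCorr v).re) := by
      rw [norm_bottcher] at hφv
      rw [Real.exp_neg]
      field_simp at hφv ⊢
      linarith
    have h2 := hexp (y := -(N.logCorr v).re) (by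
      rw [dist_zero_right, norm_neg, Real.norm_eq_abs]; exact hl.trans_lt hb)
    rw [h1, ← mul_sub_one, abs_mul, abs_of_pos h0, mul_comm]
    gcongr
  · calc ‖v 2‖ ≤ N.slope v * smallMod v := N.norm_two_le_slope_mul hv
      _ ≤ (N.width * (1 / 2) ^ n) * ‖v 0‖ :=
        mul_le_mul hs (smallMod_le_norm_castSucc v 0) (smallMod_nonneg v) (by positivity)
      _ < δ * ‖v 0‖ := by gcongr

/-- In the tube `|y|/|x|` lies between `1/2` and `2`, and the correction factor is bounded above and
below on the cone. Thus `|φ(u)|^(d^n)` is eventually confined to a compact subset of `(0, ∞)`, which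
excludes `|φ(u)| < 1` and `|φ(u)| > 1`. -/
theorem norm_bottcher_eq_one {u : Fin 3 → ℂ} (hu : u ∈ N.cone)
    (h : ∀ᶠ n in atTop, N.map^[n] u ∈ tube (1 / 2)) : ‖N.bottcher u‖ = 1 := by
  have hC := N.C_nonneg
  have hc := N.norm_c_pos
  set K := 3 * N.C / ‖N.c‖ * N.width
  have hd : 1 < d := N.two_le
  have hbd : ∀ᶠ n in atTop, Real.exp (-K) / 2 ≤ ‖N.bottcher u‖ ^ d ^ n ∧
      ‖N.bottcher u‖ ^ d ^ n ≤ 2 * Real.exp K := by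
    filter_upwards [h] with n hn
    have hv := N.iterate_map_mem_cone hu n
    rw [← norm_pow, ← N.bottcher_iterate_map hu, norm_bottcher]
    set v := N.map^[n] u
    have h0 : 0 < ‖v 0‖ := norm_pos_iff.mpr (N.castSucc_ne_zero hv 0)
    have hl : |(N.logCorr v).re| ≤ K :=
      (Complex.abs_re_le_norm _).trans ((N.norm_logCorr_le hv).trans (by
        exact mul_le_mul_of_nonneg_left (N.slope_lt hv).le (by positivity)))
    have h1 := abs_lt.mp hn.1
    have h2 := abs_le.mp hl
    constructor
    · rw [div_eq_inv_mul]
      gcongr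
      · rw [le_div_iff₀ h0]; linarith
      · linarith
    · gcongr
      · rw [div_le_iff₀ h0]; linarith
      · linarith
  have hpow := tendsto_pow_atTop_atTop_of_one_lt hd
  rcases lt_trichotomy ‖N.bottcher u‖ 1 with hlt | heq | hgt
  · have h1 := (tendsto_pow_atTop_nhds_zero_of_lt_one (norm_nonneg _) hlt).comp hpow
    have h2 := h1.eventually_lt_const (show 0 < Real.exp (-K) / 2 by positivity)
    obtain ⟨n, hn, hn'⟩ := (h2.and hbd).exists
    exact absurd hn'.1 (not_le.mpr hn)
  · exact heq
  · have h1 := (tendsto_pow_atTop_atTop_of_one_lt hgt).comp hpow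
    obtain ⟨n, hn, hn'⟩ := ((h1.eventually_gt_atTop (2 * Real.exp K)).and hbd).exists
    exact absurd hn'.2 (not_le.mpr hn)

end

end NormalForm

/-! ### The topology of projective space in homogeneous coordinates -/

section ProjectiveTopology

variable {n m : ℕ}

theorem isOpen_CP_iff {T : Set (CP n)} :
    IsOpen T ↔ IsOpen {v : {v : Fin (n + 1) → ℂ // v ≠ 0} | Projectivization.mk ℂ v.1 v.2 ∈ T} :=
  isOpen_coinduced

/-- The vectors representing the points of a subset of projective space. -/
def affineCone (T : Set (CP n)) : Set (Fin (n + 1) → ℂ) :=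
  {v | ∃ h : v ≠ 0, Projectivization.mk ℂ v h ∈ T}

theorem isOpen_affineCone {T : Set (CP n)} (hT : IsOpen T) : IsOpen (affineCone T) := by
  have h := (isOpen_ne (x := (0 : Fin (n + 1) → ℂ))).isOpenMap_subtype_val _ (isOpen_CP_iff.mp hT)
  convert h using 1
  ext v
  constructor
  · rintro ⟨h, hv⟩
    exact ⟨⟨v, h⟩, hv, rfl⟩
  · rintro ⟨w, hw, rfl⟩
    exact ⟨w.2, hw⟩

/-- The points of projective space with a representative in a given set. -/
def projSet (S : Set (Fin (n + 1) → ℂ)) : Set (CP n) := {p | p.rep ∈ S}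

/-- `projSet` tests a chosen representative; invariance under scaling makes the choice irrelevant.
-/
theorem mk_mem_projSet {S : Set (Fin (n + 1) → ℂ)} (hS : ∀ t : ℂ, t ≠ 0 → ∀ v ∈ S, t • v ∈ S)
    {v : Fin (n + 1) → ℂ} (hv : v ≠ 0) : Projectivization.mk ℂ v hv ∈ projSet S ↔ v ∈ S := by
  obtain ⟨a, ha⟩ := Projectivization.exists_smul_eq_mk_rep ℂ v hv
  rw [projSet, Set.mem_ofPred_eq, ← ha]
  refine ⟨fun h => ?_, fun h => hS a a.ne_zero v h⟩
  have := hS (a⁻¹ : ℂˣ) (a⁻¹).ne_zero _ h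
  rwa [Units.smul_def, smul_smul, Units.inv_mul, one_smul] at this

theorem isOpen_projSet {S : Set (Fin (n + 1) → ℂ)} (hS : ∀ t : ℂ, t ≠ 0 → ∀ v ∈ S, t • v ∈ S)
    (ho : IsOpen S) : IsOpen (projSet S) := by
  rw [isOpen_CP_iff]
  simp only [mk_mem_projSet hS]
  exact ho.preimage continuous_subtype_val

theorem continuous_projectivization_map (A : (Fin (n + 1) → ℂ) ≃ₗ[ℂ] (Fin (n + 1) → ℂ)) :
    Continuous (Projectivization.map A.toLinearMap A.injective : CP n → CP n) := by
  refine continuous_def.mpr fun T hT => isOpen_CP_iff.mpr ?_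
  have h := (isOpen_affineCone hT).preimage
    (A.toLinearMap.continuous_of_finiteDimensional.comp (continuous_subtype_val (p := (· ≠ 0))))
  convert h using 1
  ext v
  simp only [Set.mem_ofPred_eq, Set.mem_preimage, Projectivization.map_mk]
  exact ⟨fun h => ⟨_, h⟩, fun ⟨_, h⟩ => h⟩

end ProjectiveTopology

/-! ### Fatou sets under conjugation -/

/-- The numerator of the chordal distance is a determinant, so `A` multiplies it by `|det A|`, while
the Euclidean norms in the denominator shrink by at most a factor controlled by the norm of the
inverse of `A`. -/
theorem exists_chordalDist_map_le (A : (Fin 2 → ℂ) ≃ₗ[ℂ] (Fin 2 → ℂ)) :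
    ∃ K > 0, ∀ x y : CP 1,
      chordalDist (Projectivization.map A.toLinearMap A.injective x)
        (Projectivization.map A.toLinearMap A.injective y) ≤ K * chordalDist x y := by
  set B := A.symm.toLinearMap.toContinuousLinearMap
  set κ := 2 * (‖B‖ + 1)
  have hκ : 0 < κ := by positivity
  let size : (Fin 2 → ℂ) → ℝ := fun v => √(‖v 0‖ ^ 2 + ‖v 1‖ ^ 2)
  have hnorm : ∀ v, ‖v‖ ≤ size v := fun v => by
    refine (pi_norm_le_iff_of_nonneg (Real.sqrt_nonneg _)).mpr fun i => Real.le_sqrt_of_sq_le ?_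
    fin_cases i <;> simp
  have hsize : ∀ v, size v ≤ 2 * ‖v‖ := fun v => by
    refine (Real.sqrt_le_left (by positivity)).mpr ?_
    have h0 := pow_le_pow_left₀ (norm_nonneg _) (norm_le_pi_norm v 0) 2
    have h1 := pow_le_pow_left₀ (norm_nonneg _) (norm_le_pi_norm v 1) 2
    nlinarith [sq_nonneg ‖v‖]
  have hA : ∀ v, size v ≤ κ * size (A v) := fun v => by
    have h1 : ‖v‖ ≤ ‖B‖ * ‖A v‖ := by
      have := B.le_opNorm (A v)
      simpa [B] using this
    have h2 := norm_nonneg (A v)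
    calc size v ≤ 2 * (‖B‖ * ‖A v‖) := (hsize v).trans (by gcongr)
      _ ≤ κ * ‖A v‖ := by simp only [κ]; nlinarith
      _ ≤ _ := by gcongr; exact hnorm _
  have hpos : ∀ v, v ≠ 0 → 0 < size v := fun v hv => (norm_pos_iff.mpr hv).trans_le (hnorm v)
  set e0 := A (Pi.single 0 1)
  set e1 := A (Pi.single 1 1)
  have hlin : ∀ v, A v = v 0 • e0 + v 1 • e1 := fun v => by
    have : v = v 0 • (Pi.single 0 1 : Fin 2 → ℂ) + v 1 • (Pi.single 1 1 : Fin 2 → ℂ) := by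
      funext i; fin_cases i <;> simp
    conv_lhs => rw [this]
    simp [e0, e1]
  set Δ := ‖e0 0 * e1 1 - e0 1 * e1 0‖
  -- `Δ` is `|det A|`; the summand `1` gives a positive constant without discussing its
  -- nonvanishing.
  refine ⟨(Δ + 1) * κ ^ 2, by positivity, fun x y => ?_⟩
  induction x using Projectivization.ind with
  | h v hv =>
  induction y using Projectivization.ind with
  | h w hw =>
  rw [Projectivization.map_mk, Projectivization.map_mk, chordalDist_mk, chordalDist_mk]
  have hcross : ‖A v 0 * A w 1 - A v 1 * A w 0‖ = Δ * ‖v 0 * w 1 - v 1 * w 0‖ := by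
    rw [← norm_mul, hlin v, hlin w]
    congr 1
    simp only [Pi.add_apply, Pi.smul_apply, smul_eq_mul]
    ring
  have hAv := hpos (A v) (by simpa using hv)
  have hAw := hpos (A w) (by simpa using hw)
  have hv' := hpos v hv
  have hw' := hpos w hw
  change ‖A v 0 * A w 1 - A v 1 * A w 0‖ / (size (A v) * size (A w)) ≤
    (Δ + 1) * κ ^ 2 * (‖v 0 * w 1 - v 1 * w 0‖ / (size v * size w))
  rw [hcross, mul_div_assoc', div_le_div_iff₀ (by positivity) (by positivity)]
  have hprod : size v * size w ≤ κ * size (A v) * (κ * size (A w)) :=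
    mul_le_mul (hA v) (hA w) hw'.le (by positivity)
  calc Δ * ‖v 0 * w 1 - v 1 * w 0‖ * (size v * size w)
      ≤ (Δ + 1) * ‖v 0 * w 1 - v 1 * w 0‖ * (κ * size (A v) * (κ * size (A w))) := by
        gcongr
        linarith
    _ = _ := by ring

theorem projectivization_map_symm_apply {n : ℕ}
    (A : (Fin (n + 1) → ℂ) ≃ₗ[ℂ] (Fin (n + 1) → ℂ)) (x : CP n) :
    Projectivization.map A.toLinearMap A.injective
      (Projectivization.map A.symm.toLinearMap A.symm.injective x) = x := by
  induction x using Projectivization.ind with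
  | h v hv => simp [Projectivization.map_mk]

theorem map_mem_fatouSet {A : (Fin 2 → ℂ) ≃ₗ[ℂ] (Fin 2 → ℂ)} {g h : CP 1 → CP 1}
    (H : g ∘ Projectivization.map A.toLinearMap A.injective =
      Projectivization.map A.toLinearMap A.injective ∘ h) {x : CP 1} (hx : x ∈ fatouSet h) :
    Projectivization.map A.toLinearMap A.injective x ∈ fatouSet g := by
  obtain ⟨U, hU, hxU, hE⟩ := hx
  obtain ⟨K, hK, hχ⟩ := exists_chordalDist_map_le A
  have hc := continuous_projectivization_map A.symm
  have hl := projectivization_map_symm_apply A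
  have hr := projectivization_map_symm_apply A.symm
  set a : CP 1 → CP 1 := Projectivization.map A.toLinearMap A.injective
  set b : CP 1 → CP 1 := Projectivization.map A.symm.toLinearMap A.symm.injective
  have hiter : ∀ n z, g^[n] (a z) = a (h^[n] z) := fun n z =>
    ((show Function.Semiconj a h g from fun z => (congrFun H z).symm).iterate_right n z).symm
  refine ⟨b ⁻¹' U, hU.preimage hc, by rw [Set.mem_preimage]; exact (hr x).symm ▸ hxU,
    fun y hy ε hε => ?_⟩
  filter_upwards [(hc.tendsto y).eventually (hE (b y) hy (ε / K) (by positivity))] with y' hy' n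
  have h1 := hχ (h^[n] (b y)) (h^[n] (b y'))
  rw [← hiter, ← hiter, hl, hl] at h1
  refine h1.trans_lt ?_
  have := hy' n
  rw [lt_div_iff₀ hK] at this
  linarith

theorem map_mem_fatouSet_iff {A : (Fin 2 → ℂ) ≃ₗ[ℂ] (Fin 2 → ℂ)} {g h : CP 1 → CP 1}
    (H : g ∘ Projectivization.map A.toLinearMap A.injective =
      Projectivization.map A.toLinearMap A.injective ∘ h) {x : CP 1} :
    Projectivization.map A.toLinearMap A.injective x ∈ fatouSet g ↔ x ∈ fatouSet h := by
  refine ⟨fun hx => ?_, map_mem_fatouSet H⟩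
  have hl := projectivization_map_symm_apply A
  have hr := projectivization_map_symm_apply A.symm
  have H' : h ∘ Projectivization.map A.symm.toLinearMap A.symm.injective =
      Projectivization.map A.symm.toLinearMap A.symm.injective ∘ g := by
    funext z
    have := congrFun H (Projectivization.map A.symm.toLinearMap A.symm.injective z)
    simp only [Function.comp_apply, hl] at this
    simp only [Function.comp_apply, this]
    exact (hr _).symm
  have := map_mem_fatouSet H' hx
  rwa [show Projectivization.map A.symm.toLinearMap A.symm.injective
    (Projectivization.map A.toLinearMap A.injective x) = x from hr x] at this

/-! ### The Julia set of the power map -/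

theorem pow_ne_zero_fun {v : Fin 2 → ℂ} (hv : v ≠ 0) (N : ℕ) : (fun i => v i ^ N) ≠ 0 := by
  obtain ⟨i, hi⟩ := Function.ne_iff.mp hv
  exact Function.ne_iff.mpr ⟨i, pow_ne_zero N hi⟩

theorem powMap_mk (d : ℕ) {v : Fin 2 → ℂ} (hv : v ≠ 0) :
    powMap d (Projectivization.mk ℂ v hv) =
      Projectivization.mk ℂ (fun i => v i ^ d) (pow_ne_zero_fun hv d) := by
  simp [powMap, projMap, Projectivization.lift_mk]

theorem iterate_powMap_mk (d n : ℕ) {v : Fin 2 → ℂ} (hv : v ≠ 0) :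
    (powMap d)^[n] (Projectivization.mk ℂ v hv) =
      Projectivization.mk ℂ (fun i => v i ^ d ^ n) (pow_ne_zero_fun hv (d ^ n)) := by
  induction n with
  | zero => simp
  | succ n ih =>
    rw [Function.iterate_succ_apply', ih, powMap_mk]
    simp only [← pow_mul, pow_succ]

/-- Factoring out `s - t` leaves a sum dominated by the geometric series of ratio `r`. The Lipschitz
constant is independent of the exponent, which gives equicontinuity of all iterates at once. -/
theorem norm_pow_sub_pow_le {s t : ℂ} {r : ℝ} (hs : ‖s‖ ≤ r) (ht : ‖t‖ ≤ r) (hr : r < 1) (N : ℕ) :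
    ‖s ^ N - t ^ N‖ ≤ ‖s - t‖ / (1 - r) := by
  have hr0 : 0 ≤ r := (norm_nonneg s).trans hs
  rw [← (Commute.all s t).geom_sum₂_mul, norm_mul, mul_comm, div_eq_mul_inv]
  gcongr
  calc ‖∑ i ∈ Finset.range N, s ^ i * t ^ (N - 1 - i)‖
      ≤ ∑ i ∈ Finset.range N, r ^ i := by
        refine norm_sum_le_of_le _ fun i _ => ?_
        rw [norm_mul, norm_pow, norm_pow]
        calc ‖s‖ ^ i * ‖t‖ ^ (N - 1 - i) ≤ r ^ i * 1 := by
              gcongr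
              exact pow_le_one₀ (norm_nonneg _) (ht.trans hr.le)
          _ = _ := mul_one _
    _ ≤ ∑' i : ℕ, r ^ i :=
        (summable_geometric_of_lt_one hr0 hr).sum_le_tsum _ fun i _ => pow_nonneg hr0 i
    _ = (1 - r)⁻¹ := tsum_geometric_of_lt_one hr0 hr

theorem mk_mem_fatouSet_powMap_of_lt (d : ℕ) {v : Fin 2 → ℂ} (hv : v ≠ 0)
    (hlt : ‖v 0‖ < ‖v 1‖) : Projectivization.mk ℂ v hv ∈ fatouSet (powMap d) := by
  have hS : ∀ t : ℂ, t ≠ 0 → ∀ v ∈ {v : Fin 2 → ℂ | ‖v 0‖ < ‖v 1‖},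
      t • v ∈ {v : Fin 2 → ℂ | ‖v 0‖ < ‖v 1‖} := fun t ht v hv => by
    have := norm_pos_iff.mpr ht
    simp only [Set.mem_ofPred_eq, Pi.smul_apply, smul_eq_mul, norm_mul] at hv ⊢
    gcongr
  refine ⟨projSet {v | ‖v 0‖ < ‖v 1‖}, isOpen_projSet hS (isOpen_lt (by fun_prop) (by fun_prop)),
    (mk_mem_projSet hS hv).mpr hlt, fun y hy ε hε => ?_⟩
  induction y using Projectivization.ind with
  | h v hv =>
  have hlt : ‖v 0‖ < ‖v 1‖ := (mk_mem_projSet hS hv).mp hy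
  have hv1 : 0 < ‖v 1‖ := (norm_nonneg _).trans_lt hlt
  obtain ⟨r, hr, hr1⟩ := exists_between ((div_lt_one hv1).mpr hlt)
  rw [div_lt_iff₀ hv1] at hr
  set η := ε * (1 - r)
  have hη : 0 < η := mul_pos hε (by linarith)
  -- Homogeneous form of the conditions `|t| < r` and `|s - t| < ε (1 - r)` on the affine
  -- coordinates `s = v 0 / v 1` and `t = w 0 / w 1`.
  set T : Set (Fin 2 → ℂ) :=
    {w | ‖w 0‖ < r * ‖w 1‖ ∧ ‖v 0 * w 1 - v 1 * w 0‖ < η * (‖v 1‖ * ‖w 1‖)}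
  have hT : ∀ t : ℂ, t ≠ 0 → ∀ w ∈ T, t • w ∈ T := fun t ht w hw => by
    have ht' := norm_pos_iff.mpr ht
    constructor
    · simp only [Pi.smul_apply, smul_eq_mul, norm_mul]
      have := mul_lt_mul_of_pos_left hw.1 ht'
      linarith
    · simp only [Pi.smul_apply, smul_eq_mul]
      rw [show v 0 * (t * w 1) - v 1 * (t * w 0) = t * (v 0 * w 1 - v 1 * w 0) by ring,
        norm_mul, norm_mul]
      have := mul_lt_mul_of_pos_left hw.2 ht'
      linarith
  have hTo : IsOpen T := by
    refine IsOpen.inter (s := {w : Fin 2 → ℂ | ‖w 0‖ < r * ‖w 1‖})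
      (t := {w | ‖v 0 * w 1 - v 1 * w 0‖ < η * (‖v 1‖ * ‖w 1‖)}) ?_ ?_
    · exact isOpen_lt (by fun_prop) (by fun_prop)
    · exact isOpen_lt (by fun_prop) (by fun_prop)
  have hvT : v ∈ T := ⟨hr, by rw [mul_comm (v 1), sub_self, norm_zero]; positivity⟩
  filter_upwards [(isOpen_projSet hT hTo).mem_nhds ((mk_mem_projSet hT hv).mpr hvT)] with y' hy' n
  induction y' using Projectivization.ind with
  | h w hw =>
  obtain ⟨hw1, hw2⟩ : w ∈ T := (mk_mem_projSet hT hw).mp hy'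
  have hr0 : 0 < r := by
    by_contra h
    have := mul_nonpos_of_nonpos_of_nonneg (not_lt.mp h) hv1.le
    linarith [norm_nonneg (v 0)]
  have hw1' : 0 < ‖w 1‖ := by
    have := (norm_nonneg _).trans_lt hw1
    exact pos_of_mul_pos_right this hr0.le
  have hv10 := norm_pos_iff.mp hv1
  have hw10 := norm_pos_iff.mp hw1'
  rw [iterate_powMap_mk, iterate_powMap_mk, chordalDist_mk]
  set M := d ^ n
  have hsize : ∀ a b : ℂ, ‖b‖ ≤ √(‖a‖ ^ 2 + ‖b‖ ^ 2) := fun a b =>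
    Real.le_sqrt_of_sq_le (by have := sq_nonneg ‖a‖; linarith)
  have hs : ‖v 0 / v 1‖ ≤ r := by rw [norm_div, div_le_iff₀ hv1]; exact hr.le
  have ht : ‖w 0 / w 1‖ ≤ r := by rw [norm_div, div_le_iff₀ hw1']; exact hw1.le
  calc ‖v 0 ^ M * w 1 ^ M - v 1 ^ M * w 0 ^ M‖ / (√(‖v 0 ^ M‖ ^ 2 + ‖v 1 ^ M‖ ^ 2) *
        √(‖w 0 ^ M‖ ^ 2 + ‖w 1 ^ M‖ ^ 2))
      ≤ ‖v 0 ^ M * w 1 ^ M - v 1 ^ M * w 0 ^ M‖ / (‖v 1 ^ M‖ * ‖w 1 ^ M‖) := by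
        have : 0 < ‖v 1 ^ M‖ := norm_pos_iff.mpr (pow_ne_zero _ hv10)
        have : 0 < ‖w 1 ^ M‖ := norm_pos_iff.mpr (pow_ne_zero _ hw10)
        gcongr
        · exact hsize _ _
        · exact hsize _ _
    _ = ‖(v 0 / v 1) ^ M - (w 0 / w 1) ^ M‖ := by
        rw [← norm_mul, ← norm_div, div_pow, div_pow]
        congr 1
        field_simp
    _ ≤ ‖v 0 / v 1 - w 0 / w 1‖ / (1 - r) := norm_pow_sub_pow_le hs ht hr1 M
    _ < ε := by
        rw [div_lt_iff₀ (by linarith), show v 0 / v 1 - w 0 / w 1 =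
          (v 0 * w 1 - v 1 * w 0) / (v 1 * w 1) by field_simp, norm_div, norm_mul,
          div_lt_iff₀ (by positivity)]
        exact hw2

theorem mk_mem_fatouSet_powMap_of_ne (d : ℕ) {v : Fin 2 → ℂ} (hv : v ≠ 0)
    (hne : ‖v 0‖ ≠ ‖v 1‖) : Projectivization.mk ℂ v hv ∈ fatouSet (powMap d) := by
  rcases hne.lt_or_gt with h | h
  · exact mk_mem_fatouSet_powMap_of_lt d hv h
  -- Exchanging the coordinates commutes with the power map, so the other hemisphere follows by
  -- conjugation.
  · let A := LinearEquiv.funCongrLeft ℂ ℂ (Equiv.swap (0 : Fin 2) 1)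
    have H : powMap d ∘ Projectivization.map A.toLinearMap A.injective =
        Projectivization.map A.toLinearMap A.injective ∘ powMap d := by
      funext x
      induction x using Projectivization.ind with
      | h w hw =>
        simp only [Function.comp_apply, Projectivization.map_mk, powMap_mk]
        rfl
    rw [← map_mem_fatouSet_iff H, Projectivization.map_mk]
    refine mk_mem_fatouSet_powMap_of_lt d _ ?_
    simpa [A] using h

/-- Multiplying one coordinate by `t < 1` close to `1` gives nearby points whose iterates approach
`[0 : 1]`, while the iterates of the given point stay on the circle `|x| = |y|`. Once `t^(d^n) <
1/2` the chordal distance is at least `(1 - t^(d^n))/2 > 1/4`. -/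
theorem mk_notMem_fatouSet_powMap {d : ℕ} (hd : 2 ≤ d) {v : Fin 2 → ℂ} (hv : v ≠ 0)
    (heq : ‖v 0‖ = ‖v 1‖) : Projectivization.mk ℂ v hv ∉ fatouSet (powMap d) := by
  rintro ⟨U, -, hU, hE⟩
  have h1 := hE _ hU (1 / 4) (by norm_num)
  have hv1 : 0 < ‖v 1‖ := by
    refine norm_pos_iff.mpr fun h => hv ?_
    have h0 : v 0 = 0 := by rwa [h, norm_zero, norm_eq_zero] at heq
    funext i; fin_cases i <;> assumption
  obtain ⟨T, hTs, hT, hvT⟩ := eventually_nhds_iff.mp h1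
  have hline : Continuous fun t : ℝ => (![(t : ℂ) * v 0, v 1] : Fin 2 → ℂ) := by
    refine continuous_pi fun i => ?_
    fin_cases i
    · simp only [Fin.zero_eta, Matrix.cons_val_zero]; fun_prop
    · simp only [Fin.mk_one, Matrix.cons_val_one]; fun_prop
  have hmem : ∀ᶠ t : ℝ in 𝓝[<] 1, (![(t : ℂ) * v 0, v 1] : Fin 2 → ℂ) ∈ affineCone T := by
    refine (hline.tendsto 1).mono_left nhdsWithin_le_nhds |>.eventually
      ((isOpen_affineCone hT).mem_nhds ?_)
    have : (![((1 : ℝ) : ℂ) * v 0, v 1] : Fin 2 → ℂ) = v := by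
      funext i; fin_cases i <;> simp
    exact this.symm ▸ ⟨hv, hvT⟩
  obtain ⟨t, ⟨hw, htT⟩, ht0, ht1⟩ :=
    (hmem.and (Ioo_mem_nhdsLT (show (0 : ℝ) < 1 by norm_num))).exists
  have hlim : Tendsto (fun n : ℕ => t ^ d ^ n) atTop (𝓝 0) :=
    (tendsto_pow_atTop_nhds_zero_of_lt_one ht0.le ht1).comp
      (tendsto_pow_atTop_atTop_of_one_lt (by omega))
  obtain ⟨n, hn⟩ := (hlim.eventually_lt_const (show (0 : ℝ) < 1 / 2 by norm_num)).exists
  have h2 := hTs _ htT n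
  rw [iterate_powMap_mk, iterate_powMap_mk, chordalDist_mk] at h2
  simp only [Matrix.cons_val_zero, Matrix.cons_val_one] at h2
  set M := d ^ n
  set a := ‖v 1‖ ^ M
  have ha : 0 < a := pow_pos hv1 M
  have htM : 0 < t ^ M := pow_pos ht0 M
  have hnum : ‖v 0 ^ M * v 1 ^ M - v 1 ^ M * ((t : ℂ) * v 0) ^ M‖ = a ^ 2 * (1 - t ^ M) := by
    rw [mul_pow, show v 0 ^ M * v 1 ^ M - v 1 ^ M * ((t : ℂ) ^ M * v 0 ^ M) =
      v 0 ^ M * v 1 ^ M * ((1 - t ^ M : ℝ) : ℂ) by push_cast; ring, norm_mul, norm_mul, norm_pow,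
      norm_pow, heq, Complex.norm_real, Real.norm_of_nonneg (by linarith)]
    ring
  have hden : √(‖v 0 ^ M‖ ^ 2 + ‖v 1 ^ M‖ ^ 2) * √(‖((t : ℂ) * v 0) ^ M‖ ^ 2 + ‖v 1 ^ M‖ ^ 2) ≤
      a ^ 2 * 2 := by
    rw [← Real.sqrt_mul (by positivity)]
    refine (Real.sqrt_le_left (by positivity)).mpr ?_
    rw [mul_pow, norm_mul, norm_pow, norm_pow, norm_pow, heq, Complex.norm_real,
      Real.norm_of_nonneg ht0.le]
    have : (t ^ M) ^ 2 ≤ 1 := by nlinarith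
    have h4 : 0 ≤ a ^ 4 * (1 - (t ^ M) ^ 2) := mul_nonneg (by positivity) (by linarith)
    change (a ^ 2 + a ^ 2) * ((t ^ M * a) ^ 2 + a ^ 2) ≤ (a ^ 2 * 2) ^ 2
    nlinarith
  rw [hnum, div_lt_iff₀ (by
    have : 0 < ‖v 1 ^ M‖ := by rw [norm_pow]; exact ha
    positivity)] at h2
  nlinarith [sq_pos_of_pos ha]

theorem mk_mem_juliaSet_powMap_iff {d : ℕ} (hd : 2 ≤ d) {v : Fin 2 → ℂ} (hv : v ≠ 0) :
    Projectivization.mk ℂ v hv ∈ juliaSet (powMap d) ↔ ‖v 0‖ = ‖v 1‖ := by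
  refine ⟨fun h => ?_, fun h => mk_notMem_fatouSet_powMap hd hv h⟩
  by_contra hne
  exact h (mk_mem_fatouSet_powMap_of_ne d hv hne)

/-! ### Reduction to the normal form -/

theorem exists_norm_eval_le_of_isHomogeneous {n k : ℕ} {P : MvPolynomial (Fin n) ℂ}
    (hP : P.IsHomogeneous k) : ∃ C, 0 ≤ C ∧ ∀ v, ‖eval v P‖ ≤ C * ‖v‖ ^ k := by
  refine ⟨∑ e ∈ P.support, ‖P.coeff e‖, Finset.sum_nonneg fun _ _ => norm_nonneg _, fun v => ?_⟩
  rw [eval_eq, Finset.sum_mul]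
  refine norm_sum_le_of_le _ fun e he => ?_
  have h : ∑ i, e i = k := by
    have := hP (mem_support_iff.mp he)
    simpa [Finsupp.weight_apply, Finsupp.sum_fintype] using this
  have h2 : ∏ i ∈ e.support, ‖v‖ ^ e i = ‖v‖ ^ k := by
    rw [Finset.prod_pow_eq_pow_sum, ← h]
    congr 1
    exact Finset.sum_subset (Finset.subset_univ _) (by simp)
  rw [norm_mul, norm_prod, ← h2]
  gcongr with i _
  rw [norm_pow]
  gcongr
  exact norm_le_pi_norm v i

/-- The quotient by the last variable of the homogenization minus its part at infinity. -/
noncomputable def homogRest (d : ℕ) (P : MvPolynomial (Fin 2) ℂ) : MvPolynomial (Fin 3) ℂ :=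
  ∑ k ∈ Finset.range d, X 2 ^ (d - 1 - k) * rename Fin.castSucc (homogeneousComponent k P)

theorem homogRest_isHomogeneous (d : ℕ) (P : MvPolynomial (Fin 2) ℂ) :
    (homogRest d P).IsHomogeneous (d - 1) := by
  refine IsHomogeneous.sum _ _ _ fun k hk => ?_
  have h := (isHomogeneous_X_pow (R := ℂ) (2 : Fin 3) (d - 1 - k)).mul
    ((homogeneousComponent_isHomogeneous k P).rename_isHomogeneous (f := Fin.castSucc))
  rwa [Nat.sub_add_cancel (by have := Finset.mem_range.mp hk; omega)] at h

theorem eval_homog (d : ℕ) (P : MvPolynomial (Fin 2) ℂ) (v : Fin 3 → ℂ) :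
    eval v (homog d P) = eval (fun i : Fin 2 => v i.castSucc) (homogeneousComponent d P) +
      v 2 * eval v (homogRest d P) := by
  have h : homog d P = rename Fin.castSucc (homogeneousComponent d P) + X 2 * homogRest d P := by
    have h1 : ∑ k ∈ Finset.range d, X 2 ^ (d - k) *
        rename (Fin.castSucc : Fin 2 → Fin 3) (homogeneousComponent k P) = X 2 * homogRest d P := by
      rw [homogRest, Finset.mul_sum]
      refine Finset.sum_congr rfl fun k hk => ?_
      rw [← mul_assoc, ← pow_succ',
        show d - 1 - k + 1 = d - k by have := Finset.mem_range.mp hk; omega]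
    rw [homog, Finset.sum_range_succ, h1, Nat.sub_self, pow_zero, one_mul, add_comm]
  rw [h]
  simp [eval_rename, Function.comp_def]

/-- Liouville on the sphere: `k` is bounded on the closed unit disc, hence `h` is bounded outside it
as well as inside. -/
theorem eq_of_bounded_outside_closedBall {h k : ℂ → ℂ} (hh : Differentiable ℂ h)
    (hk : Continuous k) (heq : ∀ s, s ≠ 0 → h s = k s⁻¹) (s : ℂ) : h s = h 1 := by
  refine hh.apply_eq_apply_of_bounded ?_ s 1
  have h1 := ((isCompact_closedBall (0 : ℂ) 1).image hh.continuous).isBounded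
  have h2 := ((isCompact_closedBall (0 : ℂ) 1).image hk).isBounded
  refine (h1.union h2).subset ?_
  rintro _ ⟨s, rfl⟩
  rcases le_total ‖s‖ 1 with hs | hs
  · exact Or.inl ⟨s, by simpa using hs, rfl⟩
  · have hs0 : s ≠ 0 := norm_pos_iff.mp (zero_lt_one.trans_le hs)
    exact Or.inr ⟨s⁻¹, by simpa using inv_le_one_of_one_le₀ hs, (heq s hs0).symm⟩

/-- The proportionality factor depends only on the line through `v`. In the two affine charts it is
read off, without division, from the coordinate whose power is `1`; this gives two entire functions
`h` and `k` with `h s = k s⁻¹`, so it is constant. -/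
theorem exists_const_of_proportional_pow {d : ℕ} {B : (Fin 2 → ℂ) → Fin 2 → ℂ}
    (hB : Differentiable ℂ B) (hhom : ∀ (t : ℂ) v, B (t • v) = t ^ d • B v)
    (hprop : ∀ v, v ≠ 0 → ∃ t : ℂ, t ≠ 0 ∧ B v = t • fun i => v i ^ d) :
    ∃ c : ℂ, c ≠ 0 ∧ ∀ v, v ≠ 0 → B v = c • fun i => v i ^ d := by
  have hcoef : ∀ v : Fin 2 → ℂ, v ≠ 0 → ∀ t : ℂ, B v = t • (fun i => v i ^ d) →
      ∀ s : ℂ, s ≠ 0 → B (s • v) = t • fun i => (s • v) i ^ d := fun v _ t h s _ => by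
    rw [hhom, h]
    funext i
    simp only [Pi.smul_apply, smul_eq_mul, mul_pow]
    ring
  have hv1 : ∀ s : ℂ, (![s, 1] : Fin 2 → ℂ) ≠ 0 := fun s h => by simpa using congrFun h 1
  have hw1 : ∀ s : ℂ, (![1, s] : Fin 2 → ℂ) ≠ 0 := fun s h => by simpa using congrFun h 0
  set h : ℂ → ℂ := fun s => B ![s, 1] 1
  set k : ℂ → ℂ := fun s => B ![1, s] 0
  have dv : Differentiable ℂ fun s : ℂ => (![s, 1] : Fin 2 → ℂ) := by
    refine differentiable_pi.mpr fun i => ?_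
    fin_cases i
    · exact differentiable_id
    · exact differentiable_const _
  have dw : Differentiable ℂ fun s : ℂ => (![1, s] : Fin 2 → ℂ) := by
    refine differentiable_pi.mpr fun i => ?_
    fin_cases i
    · exact differentiable_const _
    · exact differentiable_id
  have dh : Differentiable ℂ h := differentiable_pi.mp (hB.comp dv) 1
  have dk : Differentiable ℂ k := differentiable_pi.mp (hB.comp dw) 0
  have hh : ∀ s, B ![s, 1] = h s • fun i => (![s, 1] : Fin 2 → ℂ) i ^ d := fun s => by
    obtain ⟨t, -, ht⟩ := hprop _ (hv1 s)
    have : h s = t := by simp [h, ht]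
    rw [this, ht]
  have hk : ∀ s, B ![1, s] = k s • fun i => (![1, s] : Fin 2 → ℂ) i ^ d := fun s => by
    obtain ⟨t, -, ht⟩ := hprop _ (hw1 s)
    have : k s = t := by simp [k, ht]
    rw [this, ht]
  have hhk : ∀ s, s ≠ 0 → h s = k s⁻¹ := fun s hs => by
    have e := hcoef _ (hv1 s) _ (hh s) s⁻¹ (inv_ne_zero hs)
    rw [show s⁻¹ • (![s, 1] : Fin 2 → ℂ) = ![1, s⁻¹] by
      funext i; fin_cases i <;> simp [hs]] at e
    have := congrFun e 0
    simpa using this.symm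
  have hkh : ∀ s, s ≠ 0 → k s = h s⁻¹ := fun s hs => by
    rw [hhk _ (inv_ne_zero hs), inv_inv]
  have ch := eq_of_bounded_outside_closedBall dh dk.continuous hhk
  have ck := eq_of_bounded_outside_closedBall dk dh.continuous hkh
  have h11 : k 1 = h 1 := by simpa using hkh 1 one_ne_zero
  refine ⟨h 1, ?_, fun v hv => ?_⟩
  · obtain ⟨t, ht0, ht⟩ := hprop _ (hv1 1)
    simpa [h, ht] using ht0
  · by_cases h1 : v 1 = 0
    · have h0 : v 0 ≠ 0 := fun h0 => hv (by funext i; fin_cases i <;> assumption)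
      have e := hcoef _ (hw1 0) _ (hk 0) _ h0
      rw [ck, h11, show v 0 • (![1, 0] : Fin 2 → ℂ) = v by
        funext i; fin_cases i <;> simp [h1]] at e
      exact e
    · have e := hcoef _ (hv1 (v 0 / v 1)) _ (hh _) _ h1
      rw [ch, show v 1 • (![v 0 / v 1, 1] : Fin 2 → ℂ) = v by
        funext i; fin_cases i <;> simp; field_simp] at e
      exact e

/-- The extension of a linear automorphism of `ℂ²` to `ℂ³` fixing the last coordinate. -/
def extendLinear (A : (Fin 2 → ℂ) ≃ₗ[ℂ] (Fin 2 → ℂ)) : (Fin 3 → ℂ) ≃ₗ[ℂ] (Fin 3 → ℂ) where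
  toFun u := Fin.snoc (α := fun _ => ℂ) (A fun j => u j.castSucc) (u 2)
  invFun u := Fin.snoc (α := fun _ => ℂ) (A.symm fun j => u j.castSucc) (u 2)
  map_add' u v := by
    have : (fun j : Fin 2 => (u + v) j.castSucc) =
      (fun j => u j.castSucc) + fun j => v j.castSucc := rfl
    rw [this, map_add]
    funext i
    refine Fin.lastCases ?_ (fun j => ?_) i <;>
      simp only [Pi.add_apply, Fin.snoc_last, Fin.snoc_castSucc]
  map_smul' t u := by
    have : (fun j : Fin 2 => (t • u) j.castSucc) = t • fun j => u j.castSucc := rfl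
    rw [this, map_smul]
    funext i
    refine Fin.lastCases ?_ (fun j => ?_) i <;>
      simp only [Pi.smul_apply, Fin.snoc_last, Fin.snoc_castSucc, RingHom.id_apply]
  left_inv u := by
    funext i
    refine Fin.lastCases ?_ (fun j => ?_) i
    · exact Fin.snoc_last (n := 2) ..
    · simp
  right_inv u := by
    funext i
    refine Fin.lastCases ?_ (fun j => ?_) i
    · exact Fin.snoc_last (n := 2) ..
    · simp

theorem extendLinear_castSucc (A : (Fin 2 → ℂ) ≃ₗ[ℂ] (Fin 2 → ℂ)) (u : Fin 3 → ℂ) (j : Fin 2) :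
    extendLinear A u j.castSucc = A (fun j => u j.castSucc) j := by
  change (Fin.snoc (α := fun _ => ℂ) (A fun j => u j.castSucc) (u 2) : Fin 3 → ℂ) j.castSucc = _
  exact Fin.snoc_castSucc ..

theorem extendLinear_two (A : (Fin 2 → ℂ) ≃ₗ[ℂ] (Fin 2 → ℂ)) (u : Fin 3 → ℂ) :
    extendLinear A u 2 = u 2 := by
  change (Fin.snoc (α := fun _ => ℂ) (A fun j => u j.castSucc) (u 2) : Fin 3 → ℂ) (Fin.last 2) = _
  exact Fin.snoc_last ..

/-- The homogeneous lift of the extension of `f` to the projective plane. -/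
noncomputable def lift (d : ℕ) (f : Fin 2 → MvPolynomial (Fin 2) ℂ) (v : Fin 3 → ℂ) :
    Fin 3 → ℂ := fun i => eval v (extensionPolys d f i)

theorem lift_castSucc (d : ℕ) (f : Fin 2 → MvPolynomial (Fin 2) ℂ) (v : Fin 3 → ℂ) (j : Fin 2) :
    lift d f v j.castSucc = eval (fun i : Fin 2 => v i.castSucc) (homogeneousComponent d (f j)) +
      v 2 * eval v (homogRest d (f j)) := by
  rw [← eval_homog]
  fin_cases j <;> rfl

theorem lift_two (d : ℕ) (f : Fin 2 → MvPolynomial (Fin 2) ℂ) (v : Fin 3 → ℂ) :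
    lift d f v 2 = v 2 ^ d := by
  simp [lift, extensionPolys]

/-- A conjugacy of maps of the projective line fixes the lifts only up to a scalar depending on the
vector; homogeneity and holomorphy force that scalar to be constant. -/
theorem exists_const_of_conjugate {d : ℕ} {f : Fin 2 → MvPolynomial (Fin 2) ℂ}
    (hf : IsRegular d f) {A : (Fin 2 → ℂ) ≃ₗ[ℂ] (Fin 2 → ℂ)}
    (hA : hf.atInfinity ∘ Projectivization.map A.toLinearMap A.injective =
      Projectivization.map A.toLinearMap A.injective ∘ powMap d) :
    ∃ c : ℂ, c ≠ 0 ∧ ∀ v, v ≠ 0 →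
      A.symm (fun i => eval (A v) (homogeneousComponent d (f i))) = c • fun i => v i ^ d := by
  refine exists_const_of_proportional_pow ?_ (fun t v => ?_) fun v hv => ?_
  · have h1 : Differentiable ℂ fun v : Fin 2 → ℂ =>
        (fun i => eval (A v) (homogeneousComponent d (f i)) : Fin 2 → ℂ) := by
      refine differentiable_pi.mpr fun i => ?_
      have : Differentiable ℂ fun w : Fin 2 → ℂ => eval w (homogeneousComponent d (f i)) :=
        differentiableOn_univ.mp
          (AnalyticOnNhd.eval_mvPolynomial (homogeneousComponent d (f i))).differentiableOn
      exact this.comp A.toLinearMap.toContinuousLinearMap.differentiable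
    exact A.symm.toLinearMap.toContinuousLinearMap.differentiable.comp h1
  · rw [← map_smul]
    congr 1
    funext i
    rw [map_smul, eval_smul_of_isHomogeneous (homogeneousComponent_isHomogeneous d (f i))]
    rfl
  · have h := congrFun hA (Projectivization.mk ℂ v hv)
    simp only [Function.comp_apply, Projectivization.map_mk, powMap_mk, IsRegular.atInfinity,
      projMap, Projectivization.lift_mk] at h
    rw [Projectivization.mk_eq_mk_iff] at h
    obtain ⟨a, ha⟩ := h
    refine ⟨a, a.ne_zero, ?_⟩
    have ha' : (a : ℂ) • A (fun i => v i ^ d) =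
        fun i => eval (A v) (homogeneousComponent d (f i)) := ha
    rw [← ha', map_smul, LinearEquiv.symm_apply_apply]

/-- The normal form of the homogeneous lift of a regular endomorphism whose restriction to the
line at infinity is conjugate to the power map. -/
theorem exists_normalForm {d : ℕ} (hd : 2 ≤ d) {f : Fin 2 → MvPolynomial (Fin 2) ℂ}
    (hf : IsRegular d f) {A : (Fin 2 → ℂ) ≃ₗ[ℂ] (Fin 2 → ℂ)}
    (hA : hf.atInfinity ∘ Projectivization.map A.toLinearMap A.injective =
      Projectivization.map A.toLinearMap A.injective ∘ powMap d) :
    ∃ N : NormalForm d, ∀ u, lift d f (extendLinear A u) = extendLinear A (N.map u) := by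
  obtain ⟨c, hc, hcA⟩ := exists_const_of_conjugate hf hA
  set B := A.symm.toLinearMap.toContinuousLinearMap
  set L := (extendLinear A).toLinearMap.toContinuousLinearMap
  let R : (Fin 3 → ℂ) → Fin 2 → ℂ := fun v i => eval v (homogRest d (f i))
  choose C hC0 hC using fun i => exists_norm_eval_le_of_isHomogeneous
    (homogRest_isHomogeneous d (f i))
  have hRb : ∀ v, ‖R v‖ ≤ (C 0 + C 1) * ‖v‖ ^ (d - 1) := fun v => by
    have := hC0 0
    have := hC0 1
    refine (pi_norm_le_iff_of_nonneg (by positivity)).mpr fun i => (hC i v).trans ?_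
    gcongr
    fin_cases i <;> simp <;> assumption
  have hN : ∀ (t : ℂ) u, R (t • u) = t ^ (d - 1) • R u := fun t u => by
    funext i
    exact eval_smul_of_isHomogeneous (homogRest_isHomogeneous d (f i)) t u
  have hR : AnalyticOnNhd ℂ R Set.univ := fun v _ => analyticAt_pi_iff.mpr fun i =>
    AnalyticOnNhd.eval_mvPolynomial (homogRest d (f i)) v trivial
  have hC00 := hC0 0
  have hC01 := hC0 1
  let N : NormalForm d :=
    { two_le := hd
      c := c
      c_ne := hc
      r := fun j u => B (R (L u)) j
      C := ‖B‖ * ((C 0 + C 1) * ‖L‖ ^ (d - 1))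
      C_nonneg := by positivity
      analytic := fun j u _ => by
        have h1 : AnalyticAt ℂ (fun u => B (R (L u))) u :=
          (B.analyticAt _).comp ((hR (L u) trivial).comp (L.analyticAt u))
        exact (analyticAt_pi_iff.mp h1) j
      bound := fun j u => by
        calc ‖B (R (L u)) j‖ ≤ ‖B (R (L u))‖ := norm_le_pi_norm _ j
          _ ≤ ‖B‖ * ((C 0 + C 1) * (‖L‖ * ‖u‖) ^ (d - 1)) := by
            refine (B.le_opNorm _).trans ?_
            gcongr
            refine (hRb _).trans ?_
            gcongr
            exact L.le_opNorm u
          _ = _ := by rw [mul_pow]; ring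
      homogeneous := fun j t u => by
        rw [map_smul, hN, map_smul]; rfl }
  refine ⟨N, fun u => ?_⟩
  rw [← LinearEquiv.symm_apply_eq]
  funext i
  refine Fin.lastCases ?_ (fun j => ?_) i
  · change extendLinear A.symm (lift d f (extendLinear A u)) 2 = N.map u 2
    rw [N.map_two, extendLinear_two, lift_two, extendLinear_two]
  · change extendLinear A.symm (lift d f (extendLinear A u)) j.castSucc = _
    rw [N.map_castSucc, extendLinear_castSucc]
    have e1 : (fun j : Fin 2 => lift d f (extendLinear A u) j.castSucc) =
        (fun i => eval (A fun j => u j.castSucc) (homogeneousComponent d (f i))) +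
          u 2 • R (extendLinear A u) := by
      funext j
      rw [lift_castSucc, extendLinear_two]
      simp only [extendLinear_castSucc]
      rfl
    have e2 : A.symm (fun i => eval (A fun j => u j.castSucc) (homogeneousComponent d (f i))) =
        c • fun i : Fin 2 => u i.castSucc ^ d := by
      -- The conjugacy says nothing about the zero vector, which has to be treated apart: points of
      -- `ℂ³` on the `z`-axis project to it.
      by_cases h0 : (fun j : Fin 2 => u j.castSucc) = 0
      · have h1 : ∀ j : Fin 2, u j.castSucc = 0 := congrFun h0
        rw [h0, map_zero]
        simp only [h1, zero_pow (show d ≠ 0 by omega)]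
        have h2 : (fun i => eval (0 : Fin 2 → ℂ) (homogeneousComponent d (f i))) = 0 := by
          funext i
          have := eval_smul_of_isHomogeneous (homogeneousComponent_isHomogeneous d (f i)) 0 0
          rwa [zero_smul, zero_pow (by omega), zero_mul] at this
        rw [h2, map_zero]
        funext i
        simp
      · exact hcA _ h0
    rw [e1, map_add, map_smul, e2]
    rfl

theorem extension_mk {d : ℕ} {f : Fin 2 → MvPolynomial (Fin 2) ℂ} (hf : IsRegular d f)
    {v : Fin 3 → ℂ} (hv : v ≠ 0) (hv' : lift d f v ≠ 0) :
    hf.extension (Projectivization.mk ℂ v hv) = Projectivization.mk ℂ (lift d f v) hv' := by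
  simp only [IsRegular.extension, projMap, Projectivization.lift_mk]
  rfl

/-! ### The stable set in homogeneous coordinates -/

theorem smul_mem_affineCone {n : ℕ} {T : Set (CP n)} {v : Fin (n + 1) → ℂ} {t : ℂ} (ht : t ≠ 0)
    (hv : v ∈ affineCone T) : t • v ∈ affineCone T := by
  obtain ⟨h, hT⟩ := hv
  refine ⟨smul_ne_zero ht h, ?_⟩
  rwa [(Projectivization.mk_eq_mk_iff' ℂ (t • v) v (smul_ne_zero ht h) h).mpr ⟨t, rfl⟩]

theorem lineAtInfinity_mk_eq (A : (Fin 2 → ℂ) ≃ₗ[ℂ] (Fin 2 → ℂ)) {u : Fin 3 → ℂ} (h2 : u 2 = 0)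
    (hw : A (fun j => u j.castSucc) ≠ 0) (hu : extendLinear A u ≠ 0) :
    lineAtInfinity (Projectivization.mk ℂ (A fun j => u j.castSucc) hw) =
      Projectivization.mk ℂ (extendLinear A u) hu := by
  simp only [lineAtInfinity, Projectivization.lift_mk]
  congr 1
  funext i
  refine Fin.lastCases ?_ (fun j => ?_) i
  · exact ((extendLinear_two A u).trans h2).symm
  · rw [extendLinear_castSucc]
    fin_cases j <;> rfl

/-! ### The Julia set at infinity in normal-form coordinates. -/

section Julia

variable {d : ℕ} {f : Fin 2 → MvPolynomial (Fin 2) ℂ} {hf : IsRegular d f}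
  {A : (Fin 2 → ℂ) ≃ₗ[ℂ] (Fin 2 → ℂ)}

theorem map_mk_mem_juliaSet_atInfinity_iff (hd : 2 ≤ d)
    (hA : hf.atInfinity ∘ Projectivization.map A.toLinearMap A.injective =
      Projectivization.map A.toLinearMap A.injective ∘ powMap d) {v : Fin 2 → ℂ} (hv : v ≠ 0)
    (hAv : A v ≠ 0) :
    Projectivization.mk ℂ (A v) hAv ∈ juliaSet hf.atInfinity ↔ ‖v 0‖ = ‖v 1‖ := by
  rw [← mk_mem_juliaSet_powMap_iff hd hv, juliaSet, juliaSet, Set.mem_compl_iff, Set.mem_compl_iff,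
    ← map_mem_fatouSet_iff hA]
  rfl

theorem mk_mem_juliaAtInfinity (hd : 2 ≤ d)
    (hA : hf.atInfinity ∘ Projectivization.map A.toLinearMap A.injective =
      Projectivization.map A.toLinearMap A.injective ∘ powMap d) {u : Fin 3 → ℂ}
    (hu : extendLinear A u ≠ 0) (h2 : u 2 = 0) (h01 : ‖u 0‖ = ‖u 1‖) :
    Projectivization.mk ℂ (extendLinear A u) hu ∈ hf.juliaAtInfinity := by
  have hv : (fun j : Fin 2 => u j.castSucc) ≠ 0 := fun h => hu (by
    rw [show u = 0 by
      funext i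
      refine Fin.lastCases h2 (fun j => congrFun h j) i, map_zero])
  have hw : A (fun j => u j.castSucc) ≠ 0 := by simpa using hv
  exact ⟨_, (map_mk_mem_juliaSet_atInfinity_iff hd hA hv hw).mpr h01,
    lineAtInfinity_mk_eq A h2 hw hu⟩

theorem exists_rep_of_mem_juliaAtInfinity (hd : 2 ≤ d)
    (hA : hf.atInfinity ∘ Projectivization.map A.toLinearMap A.injective =
      Projectivization.map A.toLinearMap A.injective ∘ powMap d) {p : CP 2}
    (hp : p ∈ hf.juliaAtInfinity) :
    ∃ (u : Fin 3 → ℂ) (hu : extendLinear A u ≠ 0), p = Projectivization.mk ℂ (extendLinear A u) hu ∧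
      u 2 = 0 ∧ ‖u 0‖ = ‖u 1‖ ∧ u 0 ≠ 0 := by
  obtain ⟨x, hx, rfl⟩ := hp
  induction x using Projectivization.ind with
  | h w hw =>
  obtain ⟨v, rfl⟩ := A.surjective w
  have hv : v ≠ 0 := by simpa using hw
  have h01 := (map_mk_mem_juliaSet_atInfinity_iff hd hA hv hw).mp hx
  have hv0 : v 0 ≠ 0 := fun h => hv (by
    have h1 : v 1 = 0 := by rwa [h, norm_zero, eq_comm, norm_eq_zero] at h01
    funext i; fin_cases i <;> assumption)
  let u : Fin 3 → ℂ := Fin.snoc (α := fun _ => ℂ) v 0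
  have hu2 : u 2 = 0 := Fin.snoc_last (n := 2) ..
  have huj : (fun j : Fin 2 => u j.castSucc) = v :=
    funext fun j => Fin.snoc_castSucc (α := fun _ : Fin 3 => ℂ) ..
  have hu0 : u 0 = v 0 := congrFun huj 0
  have hu1 : u 1 = v 1 := congrFun huj 1
  have hu : extendLinear A u ≠ 0 := by
    refine (LinearEquiv.map_ne_zero_iff _).mpr fun h => hv0 ?_
    rw [← hu0, h]; rfl
  refine ⟨u, hu, ?_, hu2, by rw [hu0, hu1, h01], by rwa [hu0]⟩
  rw [← lineAtInfinity_mk_eq A hu2 (by rwa [huj]) hu]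
  simp only [huj]

/-- The lifted Julia set, normalized by `u 0 = 1`, is a compact circle, so an open set containing it
contains a uniform thickening; homogeneity spreads this to the whole tube. -/
theorem exists_tube_subset (hd : 2 ≤ d)
    (hA : hf.atInfinity ∘ Projectivization.map A.toLinearMap A.injective =
      Projectivization.map A.toLinearMap A.injective ∘ powMap d) {Ω : Set (CP 2)} (hΩ : IsOpen Ω)
    (hJ : hf.juliaAtInfinity ⊆ Ω) :
    ∃ δ > 0, ∀ u ∈ NormalForm.tube δ, extendLinear A u ∈ affineCone Ω := by
  set K : Set (Fin 3 → ℂ) := {u | u 0 = 1 ∧ ‖u 1‖ = 1 ∧ u 2 = 0}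
  have hK : IsCompact K := by
    refine Metric.isCompact_of_isClosed_isBounded ?_ ?_
    · refine IsClosed.inter (s₁ := {u : Fin 3 → ℂ | u 0 = 1}) (s₂ := {u | ‖u 1‖ = 1 ∧ u 2 = 0})
        (isClosed_eq (by fun_prop) (by fun_prop)) ?_
      exact IsClosed.inter (s₁ := {u : Fin 3 → ℂ | ‖u 1‖ = 1}) (s₂ := {u | u 2 = 0})
        (isClosed_eq (by fun_prop) (by fun_prop)) (isClosed_eq (by fun_prop) (by fun_prop))
    · refine (Metric.isBounded_closedBall (x := (0 : Fin 3 → ℂ)) (r := 1)).subset ?_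
      rintro u ⟨h0, h1, h2⟩
      rw [mem_closedBall_zero_iff]
      refine (pi_norm_le_iff_of_nonneg zero_le_one).mpr fun i => ?_
      fin_cases i
      · exact (congrArg norm h0).trans norm_one |>.le
      · exact h1.le
      · exact ((congrArg norm h2).trans norm_zero).le.trans zero_le_one
  have hW : IsOpen (extendLinear A ⁻¹' affineCone Ω) :=
    (isOpen_affineCone hΩ).preimage (extendLinear A).toLinearMap.continuous_of_finiteDimensional
  have hKW : K ⊆ extendLinear A ⁻¹' affineCone Ω := by
    rintro u ⟨h0, h1, h2⟩
    have hu : extendLinear A u ≠ 0 := by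
      refine (LinearEquiv.map_ne_zero_iff _).mpr fun h => ?_
      rw [h] at h0
      exact zero_ne_one h0
    exact ⟨hu, hJ (mk_mem_juliaAtInfinity hd hA hu h2 (by rw [h0, h1, norm_one]))⟩
  obtain ⟨δ, hδ, hsub⟩ := hK.exists_thickening_subset_open hW hKW
  -- The bound by `1` keeps the normalized second coordinate nonzero, so that it can be projected
  -- radially to the unit circle.
  refine ⟨min δ 1, by positivity, fun u hu => ?_⟩
  have hu0 : 0 < ‖u 0‖ := by
    have := (norm_nonneg _).trans_lt hu.2
    exact pos_of_mul_pos_right this (by positivity)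
  have hu0' : u 0 ≠ 0 := norm_pos_iff.mp hu0
  set w := (u 0)⁻¹ • u
  have hw0 : w 0 = 1 := by simp [w, hu0']
  have hw1 : |‖w 1‖ - 1| < min δ 1 := by
    have : ‖w 1‖ - 1 = (‖u 1‖ - ‖u 0‖) / ‖u 0‖ := by
      simp only [w, Pi.smul_apply, smul_eq_mul, norm_mul, norm_inv]; field_simp
    rw [this, abs_div, abs_of_pos hu0, div_lt_iff₀ hu0]
    exact hu.1
  have hw2 : ‖w 2‖ < min δ 1 := by
    simp only [w, Pi.smul_apply, smul_eq_mul, norm_mul, norm_inv]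
    rw [inv_mul_lt_iff₀ hu0, mul_comm]
    exact hu.2
  have hw1p : 0 < ‖w 1‖ := by
    have := (abs_lt.mp (hw1.trans_le (min_le_right _ _))).1
    linarith
  have hw1c : (‖w 1‖ : ℂ) ≠ 0 := by exact_mod_cast hw1p.ne'
  have hwW : w ∈ extendLinear A ⁻¹' affineCone Ω := by
    refine hsub (Metric.mem_thickening_iff.mpr
      ⟨![1, w 1 / ‖w 1‖, 0], ⟨rfl, ?_, rfl⟩, (dist_pi_lt_iff hδ).mpr fun i => ?_⟩)
    · simp [hw1p.ne']
    · fin_cases i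
      · simpa [hw0] using hδ
      · change dist (w 1) (w 1 / ‖w 1‖) < δ
        rw [dist_eq_norm, show w 1 - w 1 / ‖w 1‖ = w 1 / ‖w 1‖ * ((‖w 1‖ - 1 : ℝ) : ℂ) by
          push_cast; field_simp, norm_mul, norm_div, Complex.norm_real, Complex.norm_real,
          Real.norm_of_nonneg hw1p.le, div_self hw1p.ne', one_mul]
        exact hw1.trans_le (min_le_left _ _)
      · change dist (w 2) 0 < δ
        rw [dist_zero_right]
        exact hw2.trans_le (min_le_left _ _)
  have := smul_mem_affineCone hu0' hwW
  rwa [← map_smul, smul_smul, mul_inv_cancel₀ hu0', one_smul] at this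

end Julia

theorem ne_zero_of_mem_cone {d : ℕ} {N : NormalForm d} {u : Fin 3 → ℂ} (hu : u ∈ N.cone) :
    u ≠ 0 := fun h => N.castSucc_ne_zero hu 0 (by rw [h]; rfl)

/-! ### The stable set and the level set where the Böttcher quotient has modulus one. -/

section Stable

variable {d : ℕ} {f : Fin 2 → MvPolynomial (Fin 2) ℂ} {hf : IsRegular d f}
  {A : (Fin 2 → ℂ) ≃ₗ[ℂ] (Fin 2 → ℂ)} {N : NormalForm d}

theorem iterate_extension_mk (hN : ∀ u, lift d f (extendLinear A u) = extendLinear A (N.map u))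
    {u : Fin 3 → ℂ} (hu : u ∈ N.cone) (n : ℕ) (h : extendLinear A u ≠ 0)
    (hn : extendLinear A (N.map^[n] u) ≠ 0) :
    hf.extension^[n] (Projectivization.mk ℂ (extendLinear A u) h) =
      Projectivization.mk ℂ (extendLinear A (N.map^[n] u)) hn := by
  induction n with
  | zero => rfl
  | succ n ih =>
    have hn' : extendLinear A (N.map^[n] u) ≠ 0 :=
      (LinearEquiv.map_ne_zero_iff _).mpr (ne_zero_of_mem_cone (N.iterate_map_mem_cone hu n))
    have hn'' : lift d f (extendLinear A (N.map^[n] u)) ≠ 0 := by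
      rw [hN, ← Function.iterate_succ_apply' N.map]
      exact hn
    rw [Function.iterate_succ_apply', ih hn', extension_mk hf hn' hn'']
    congr 1
    rw [hN, ← Function.iterate_succ_apply' N.map]

theorem iterate_extension_mk_mem_iff
    (hN : ∀ u, lift d f (extendLinear A u) = extendLinear A (N.map u))
    {u : Fin 3 → ℂ} (hu : u ∈ N.cone) (n : ℕ) (h : extendLinear A u ≠ 0) {T : Set (CP 2)} :
    hf.extension^[n] (Projectivization.mk ℂ (extendLinear A u) h) ∈ T ↔
      extendLinear A (N.map^[n] u) ∈ affineCone T := by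
  have hn : extendLinear A (N.map^[n] u) ≠ 0 :=
    (LinearEquiv.map_ne_zero_iff _).mpr (ne_zero_of_mem_cone (N.iterate_map_mem_cone hu n))
  rw [iterate_extension_mk hN hu n h hn]
  exact ⟨fun h => ⟨hn, h⟩, fun ⟨_, h⟩ => h⟩

theorem smul_mem_tube {δ : ℝ} {t : ℂ} (ht : t ≠ 0) {u : Fin 3 → ℂ}
    (hu : u ∈ NormalForm.tube δ) : t • u ∈ NormalForm.tube δ := by
  have ht' := norm_pos_iff.mpr ht
  have h1 := mul_lt_mul_of_pos_left hu.1 ht'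
  have h2 := mul_lt_mul_of_pos_left hu.2 ht'
  constructor
  · simp only [Pi.smul_apply, smul_eq_mul, norm_mul]
    rw [← mul_sub, abs_mul, abs_of_pos ht']
    linarith
  · simp only [Pi.smul_apply, smul_eq_mul, norm_mul]
    linarith

theorem isOpen_tube (δ : ℝ) : IsOpen (NormalForm.tube δ) := by
  refine IsOpen.inter (s := {u : Fin 3 → ℂ | |‖u 1‖ - ‖u 0‖| < δ * ‖u 0‖})
    (t := {u | ‖u 2‖ < δ * ‖u 0‖}) ?_ ?_
  · exact isOpen_lt (by fun_prop) (by fun_prop)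
  · exact isOpen_lt (by fun_prop) (by fun_prop)

theorem isOpen_extendLinear_symm_preimage (A : (Fin 2 → ℂ) ≃ₗ[ℂ] (Fin 2 → ℂ))
    {S : Set (Fin 3 → ℂ)} (hS : IsOpen S) : IsOpen ((extendLinear A).symm ⁻¹' S) :=
  hS.preimage (extendLinear A).symm.toLinearMap.continuous_of_finiteDimensional

theorem smul_mem_extendLinear_symm_preimage (A : (Fin 2 → ℂ) ≃ₗ[ℂ] (Fin 2 → ℂ))
    {S : Set (Fin 3 → ℂ)} (hS : ∀ t : ℂ, t ≠ 0 → ∀ v ∈ S, t • v ∈ S) (t : ℂ) (ht : t ≠ 0)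
    (v : Fin 3 → ℂ) (hv : v ∈ (extendLinear A).symm ⁻¹' S) :
    t • v ∈ (extendLinear A).symm ⁻¹' S := by
  rw [Set.mem_preimage, map_smul]
  exact hS t ht _ hv

/-- The tube of size `1/2` descends to a neighbourhood of the Julia set, so a convergent orbit
eventually stays in it. -/
theorem norm_bottcher_eq_one_of_tendsto (hd : 2 ≤ d)
    (hA : hf.atInfinity ∘ Projectivization.map A.toLinearMap A.injective =
      Projectivization.map A.toLinearMap A.injective ∘ powMap d)
    (hN : ∀ u, lift d f (extendLinear A u) = extendLinear A (N.map u))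
    {u : Fin 3 → ℂ} (hu : u ∈ N.cone) (h : extendLinear A u ≠ 0)
    (hlim : Tendsto
      (fun n => hf.extension^[n] (Projectivization.mk ℂ (extendLinear A u) h)) atTop
      (𝓝ˢ hf.juliaAtInfinity)) : ‖N.bottcher u‖ = 1 := by
  have hinv := smul_mem_extendLinear_symm_preimage A (S := NormalForm.tube (1 / 2))
    fun t ht v hv => smul_mem_tube ht hv
  have hopen := isOpen_projSet hinv (isOpen_extendLinear_symm_preimage A (isOpen_tube (1 / 2)))
  have hJ : hf.juliaAtInfinity ⊆ projSet ((extendLinear A).symm ⁻¹' NormalForm.tube (1 / 2)) := by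
    intro p hp
    obtain ⟨w, hw, rfl, h2, h01, h0⟩ := exists_rep_of_mem_juliaAtInfinity hd hA hp
    rw [mk_mem_projSet hinv, Set.mem_preimage, LinearEquiv.symm_apply_apply]
    have := norm_pos_iff.mpr h0
    constructor
    · rw [h01, sub_self, abs_zero, ← h01]; positivity
    · rw [h2, norm_zero]; positivity
  refine N.norm_bottcher_eq_one hu ?_
  filter_upwards [hlim.eventually (hopen.mem_nhdsSet.mpr hJ)] with n hn
  obtain ⟨h', hn'⟩ := (iterate_extension_mk_mem_iff hN hu n h
    (T := projSet ((extendLinear A).symm ⁻¹' NormalForm.tube (1 / 2)))).mp hn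
  rw [mk_mem_projSet hinv, Set.mem_preimage, LinearEquiv.symm_apply_apply] at hn'
  exact hn'

/-- Every neighbourhood of the Julia set contains a tube, and on the unit level the orbit enters
every tube for good. -/
theorem mk_mem_localStableSet_of_norm_bottcher_eq_one (hd : 2 ≤ d)
    (hA : hf.atInfinity ∘ Projectivization.map A.toLinearMap A.injective =
      Projectivization.map A.toLinearMap A.injective ∘ powMap d)
    (hN : ∀ u, lift d f (extendLinear A u) = extendLinear A (N.map u))
    {u : Fin 3 → ℂ} (hu : u ∈ N.cone) (h : extendLinear A u ≠ 0) (hφ : ‖N.bottcher u‖ = 1)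
    {Ω : Set (CP 2)} (hΩ : ∀ n, extendLinear A (N.map^[n] u) ∈ affineCone Ω) :
    Projectivization.mk ℂ (extendLinear A u) h ∈
      localStableSet hf.extension hf.juliaAtInfinity Ω := by
  refine ⟨fun n => (iterate_extension_mk_mem_iff hN hu n h).mpr (hΩ n), ?_⟩
  intro T hT
  obtain ⟨T', hT'o, hJT', hT'T⟩ := mem_nhdsSet_iff_exists.mp hT
  obtain ⟨δ, hδ, hsub⟩ := exists_tube_subset hd hA hT'o hJT'
  obtain ⟨n₀, hn₀⟩ := N.exists_forall_iterate_mem_tube hδ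
  refine mem_map.mpr (mem_atTop_sets.mpr ⟨n₀, fun n hn => hT'T ?_⟩)
  exact (iterate_extension_mk_mem_iff hN hu n h).mpr (hsub _ (hn₀ n hn u hu hφ))

end Stable

/-! ### Level sets of the modulus of a holomorphic submersion -/

/-- As `D` is nonzero and complex linear, some direction is sent to `Φ y` itself; in that direction
`|Φ|²` has derivative `2 |Φ y|² > 0`. -/
theorem fderiv_normSq_sub_one_ne_zero {E : Type*} [NormedAddCommGroup E] [NormedSpace ℂ E]
    {Φ : E → ℂ} {D : E →L[ℂ] ℂ} {y : E} (hΦ : HasFDerivAt Φ D y) (hD : D ≠ 0) (h0 : Φ y ≠ 0) :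
    fderiv ℝ (fun b => (Φ b).re * (Φ b).re + (Φ b).im * (Φ b).im - 1) y ≠ 0 := by
  have hre : HasFDerivAt (fun b => (Φ b).re) (Complex.reCLM.comp (D.restrictScalars ℝ)) y :=
    Complex.reCLM.hasFDerivAt.comp y (hΦ.restrictScalars ℝ)
  have him : HasFDerivAt (fun b => (Φ b).im) (Complex.imCLM.comp (D.restrictScalars ℝ)) y :=
    Complex.imCLM.hasFDerivAt.comp y (hΦ.restrictScalars ℝ)
  have hψ := ((hre.mul hre).add (him.mul him)).sub_const 1
  obtain ⟨x, hx⟩ := DFunLike.ne_iff.mp hD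
  have hx' : D x ≠ 0 := hx
  have hDx : D ((Φ y / D x) • x) = Φ y := by
    rw [map_smul, smul_eq_mul, div_mul_cancel₀ _ hx']
  intro h
  have h1 := DFunLike.congr_fun (hψ.fderiv.symm.trans h) ((Φ y / D x) • x)
  simp only [zero_apply, add_apply,
    smul_apply, ContinuousLinearMap.comp_apply,
    ContinuousLinearMap.coe_restrictScalars', hDx, Complex.reCLM_apply, Complex.imCLM_apply,
    smul_eq_mul] at h1
  have h2 : 0 < Complex.normSq (Φ y) := Complex.normSq_pos.mpr h0
  rw [Complex.normSq_apply] at h2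
  linarith

theorem analyticAt_normSq_sub_one {E : Type*} [NormedAddCommGroup E] [NormedSpace ℂ E]
    {Φ : E → ℂ} {y : E} (hΦ : AnalyticAt ℂ Φ y) :
    AnalyticAt ℝ (fun b => (Φ b).re * (Φ b).re + (Φ b).im * (Φ b).im - 1) y := by
  have h := hΦ.restrictScalars (𝕜 := ℝ)
  have hre : AnalyticAt ℝ (fun b => (Φ b).re) y := (Complex.reCLM.analyticAt _).comp h
  have him : AnalyticAt ℝ (fun b => (Φ b).im) y := (Complex.imCLM.analyticAt _).comp h
  exact ((hre.mul hre).add (him.mul him)).sub analyticAt_const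

/-! ### Affine charts -/

/-- The linear part of the lift of an affine chart to homogeneous coordinates. -/
def chartLinear (i : Fin 3) : (Fin 2 → ℂ) →ₗ[ℂ] (Fin 3 → ℂ) where
  toFun a := Fin.insertNth (α := fun _ => ℂ) i 0 a
  map_add' a b := by
    funext k
    refine Fin.succAboveCases i ?_ (fun j => ?_) k <;> simp
  map_smul' t a := by
    funext k
    refine Fin.succAboveCases i ?_ (fun j => ?_) k <;> simp

theorem insertNth_one_eq (i : Fin 3) (a : Fin 2 → ℂ) :
    (Fin.insertNth i (1 : ℂ) a : Fin 3 → ℂ) =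
      (Pi.single i 1 : Fin 3 → ℂ) + (chartLinear i).toContinuousLinearMap a := by
  funext k
  refine Fin.succAboveCases i ?_ (fun j => ?_) k <;> simp [chartLinear]

/-- A point of the affine slice and the directions tangent to the slice span `ℂ³`. Together with
Euler's identity this shows that the quotient loses no derivative when restricted to a chart. -/
theorem exists_eq_smul_insertNth_add_chartLinear (i : Fin 3) (a : Fin 2 → ℂ) (v : Fin 3 → ℂ) :
    ∃ b, v = v i • (Fin.insertNth i (1 : ℂ) a : Fin 3 → ℂ) + chartLinear i b := by
  refine ⟨fun j => v (i.succAbove j) - v i * a j, ?_⟩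
  funext k
  refine Fin.succAboveCases i ?_ (fun j => ?_) k <;> simp [chartLinear]

end RegEndo

/-! ### Proof of the theorem in the affine charts. -/

open RegEndo in
theorem mainTheorem6 (d : ℕ) (hd : 2 ≤ d) (f : Fin 2 → MvPolynomial (Fin 2) ℂ)
    (hf : RegEndo.IsRegular d f)
    (hconj : RegEndo.MobiusConjugate hf.atInfinity (RegEndo.powMap d)) :
    ∃ Ω₀ : Set (RegEndo.CP 2), IsOpen Ω₀ ∧ hf.juliaAtInfinity ⊆ Ω₀ ∧
      ∀ Ω : Set (RegEndo.CP 2), IsOpen Ω → hf.juliaAtInfinity ⊆ Ω → Ω ⊆ Ω₀ →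
        RegEndo.IsRealAnalyticHypersurfaceCP2
          (RegEndo.localStableSet hf.extension hf.juliaAtInfinity Ω) := by
  obtain ⟨A, hA⟩ := hconj
  obtain ⟨N, hN⟩ := exists_normalForm hd hf hA
  set L := extendLinear A
  have hinv := smul_mem_extendLinear_symm_preimage A (S := N.regularCone)
    fun t ht v hv => N.smul_mem_regularCone ht hv
  -- `Ω₀` depends only on the normal form; `Ω` enters later, through `δ` and `n₀`.
  refine ⟨projSet (L.symm ⁻¹' N.regularCone),
    isOpen_projSet hinv (isOpen_extendLinear_symm_preimage A N.isOpen_regularCone), ?_, ?_⟩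
  · intro p hp
    obtain ⟨u, hu, rfl, h2, h01, h0⟩ := exists_rep_of_mem_juliaAtInfinity hd hA hp
    rw [mk_mem_projSet hinv, Set.mem_preimage, LinearEquiv.symm_apply_apply]
    have hcone : u ∈ N.cone := by
      change ‖u 2‖ * bigMod u ^ (d - 1) < N.width * smallMod u ^ d
      have := N.width_pos
      have hm : 0 < smallMod u := lt_min (norm_pos_iff.mpr h0) (h01 ▸ norm_pos_iff.mpr h0)
      rw [h2, norm_zero, zero_mul]
      positivity
    exact ⟨hcone, N.fderiv_bottcher_ne_zero hcone h2⟩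
  · intro Ω hΩ hJΩ hΩ₀ i x hx
    obtain ⟨δ, hδ, hsub⟩ := exists_tube_subset hd hA hΩ hJΩ
    obtain ⟨n₀, hn₀⟩ := N.exists_forall_iterate_mem_tube hδ
    let B : (Fin 2 → ℂ) →L[ℂ] (Fin 3 → ℂ) :=
      L.symm.toLinearMap.toContinuousLinearMap.comp (chartLinear i).toContinuousLinearMap
    let u : (Fin 2 → ℂ) → (Fin 3 → ℂ) := fun b => L.symm (Fin.insertNth i (1 : ℂ) b : Fin 3 → ℂ)
    have hu : u = fun b => L.symm (Pi.single i 1) + B b := by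
      funext b
      change L.symm _ = _
      rw [insertNth_one_eq, map_add]
      rfl
    have hLu : ∀ b, L (u b) = Fin.insertNth i (1 : ℂ) b := fun b => L.apply_symm_apply _
    have hne : ∀ b, L (u b) ≠ 0 := fun b h => by
      have := congrFun ((hLu b).symm.trans h) i
      simp at this
    have hchart : ∀ b, affineChart i b = Projectivization.mk ℂ (L (u b)) (hne b) := fun b => by
      simp only [affineChart, hLu]
    have hud : ∀ b, HasFDerivAt u B b := fun b => by
      rw [hu]; exact B.hasFDerivAt.const_add _
    have huc : Continuous u := continuous_iff_continuousAt.mpr fun b => (hud b).continuousAt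
    have hua : ∀ b, AnalyticAt ℂ u b := fun b => by
      rw [hu]; exact analyticAt_const.add (B.analyticAt b)
    have hmem : ∀ b, affineChart i b ∈ localStableSet hf.extension hf.juliaAtInfinity Ω →
        u b ∈ N.regularCone ∧ ‖N.bottcher (u b)‖ = 1 ∧
          ∀ n, L (N.map^[n] (u b)) ∈ affineCone Ω := fun b hb => by
      rw [hchart] at hb
      have h1 : u b ∈ N.regularCone := by
        have := hΩ₀ (hb.1 0)
        rw [Function.iterate_zero, id, mk_mem_projSet hinv, Set.mem_preimage,
          LinearEquiv.symm_apply_apply] at this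
        exact this
      exact ⟨h1, norm_bottcher_eq_one_of_tendsto hd hA hN h1.1 (hne b) hb.2,
        fun n => (iterate_extension_mk_mem_iff hN h1.1 n (hne b)).mp (hb.1 n)⟩
    let Φ : (Fin 2 → ℂ) → ℂ := fun b => N.bottcher (u b)
    have hlevel : ∀ b, (Φ b).re * (Φ b).re + (Φ b).im * (Φ b).im - 1 = 0 ↔
        ‖N.bottcher (u b)‖ = 1 := fun b => by
      rw [sub_eq_zero, ← Complex.normSq_apply, Complex.normSq_eq_norm_sq,
        pow_eq_one_iff_of_nonneg (norm_nonneg _) two_ne_zero]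
    -- Only the first `n₀` iterates are required to lie in `Ω`: a finite intersection, hence open.
    -- The defining function is `|φ|² - 1` in the chart.
    refine ⟨u ⁻¹' N.regularCone ∩ ⋂ n ∈ Finset.range n₀, {b | L (N.map^[n] (u b)) ∈ affineCone Ω},
      fun b => (Φ b).re * (Φ b).re + (Φ b).im * (Φ b).im - 1, ?_, ?_, ?_, ?_, ?_⟩
    · refine (N.isOpen_regularCone.preimage huc).inter (isOpen_biInter_finset fun n _ => ?_)
      exact (isOpen_affineCone hΩ).preimage
        (L.toLinearMap.continuous_of_finiteDimensional.comp ((N.continuous_iterate_map n).comp huc))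
    · obtain ⟨h1, -, h3⟩ := hmem x hx
      exact ⟨h1, Set.mem_iInter₂.mpr fun n _ => h3 n⟩
    · exact fun y hy => analyticAt_normSq_sub_one ((N.analyticAt_bottcher hy.1.1).comp (hua y))
    · rintro y ⟨hy, -⟩
      refine fderiv_normSq_sub_one_ne_zero (D := (fderiv ℂ N.bottcher (u y)).comp B)
        ((N.analyticAt_bottcher hy.1).differentiableAt.hasFDerivAt.comp y (hud y)) (fun h => ?_)
        (N.bottcher_ne_zero hy.1)
      -- If the derivative vanished along the chart it would vanish on all of `ℂ³`, since it already
      -- kills the radial vector `u y`.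
      refine hy.2 (ContinuousLinearMap.ext fun w => ?_)
      obtain ⟨b, hb⟩ := exists_eq_smul_insertNth_add_chartLinear i y (L w)
      have hw : w = (L w) i • u y + B b := by
        conv_lhs => rw [← L.symm_apply_apply w, hb, map_add, map_smul]
        rfl
      have hBb : fderiv ℂ N.bottcher (u y) (B b) = 0 := DFunLike.congr_fun h b
      rw [hw, map_add, map_smul, N.fderiv_bottcher_self hy.1, hBb]
      simp
    · ext b
      refine and_congr_left fun ⟨hb, hbn⟩ => ?_
      refine (⟨fun h => (hmem b h).2.1, fun h => ?_⟩ : _ ↔ ‖N.bottcher (u b)‖ = 1).trans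
        (hlevel b).symm
      rw [hchart]
      refine mk_mem_localStableSet_of_norm_bottcher_eq_one hd hA hN hb.1 (hne b) h fun n => ?_
      -- Early iterates lie in `Ω` by the choice of neighbourhood, later ones because they lie in a
      -- tube contained in `Ω`.
      rcases lt_or_ge n n₀ with hn | hn
      · exact Set.mem_iInter₂.mp hbn n (Finset.mem_range.mpr hn)
      · exact hsub _ (hn₀ n hn _ hb.1 h)
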